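/- All digraphs are finite and have no loops and no parallel arcs. A digraph $D$ is Eulerian if $d^+(v)=d^-(v)$ for every vertex $v$ (connectedness is not required), and symmetric if $vu$ is an arc whenever $uv$ is. For $S\subseteq V(D)$ with $|S|\ge 2$ and $r\in S$, an $(S,r)$-tree is an out-tree contained in $D$ (an oriented tree in which every vertex except the root has in-degree one) with root $r$ whose vertex set contains $S$; $\lambda_{S,r}(D)$ is the maximum number of pairwise arc-disjoint $(S,r)$-trees in $D$, and $\lambda_D(x,y)$ is the maximum number of pairwise arc-disjoint directed paths from $x$ to $y$ in $D$. **Theorem.** Let $D$ be an Eulerian digraph, let $S\subseteq V(D)$ with $|S|\ge 2$, let $r\in S$, and let $\ell\ge 0$ be an integer. Then $\lambda_{S,r}(D)\ge \ell$ if and only if $\lambda_D(r,s)\ge \ell$ for every $s\in S\setminus\{r\}$. As a consequence, the problem of deciding, given an Eulerian digraph $D$, a set $S\subseteq V(D)$ with $|S|\ge 2$, a vertex $r\in S$ and an integer $\ell\ge 0$, whether $\lambda_{S,r}(D)\ge \ell$ is solvable in polynomial time; here $|S|$ and $\ell$ are part of the input, $D$ is given by its adjacency matrix and $\ell$ in binary.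 Hence so is the same problem restricted to symmetric digraphs. -/

import Mathlib

/-! ## Digraphs, paths, out-trees, and the two connectivities

`Digraph V` has no parallel arcs; loops are excluded by `DiTree.Loopless`. -/

namespace DiTree

variable {V : Type*}

/-- `D` has no loops. -/
def Loopless (D : Digraph V) : Prop := ∀ v, ¬ D.Adj v v

/-- Out-degree of `v`. -/
noncomputable def outDeg (D : Digraph V) (v : V) : ℕ := {w | D.Adj v w}.ncard

/-- In-degree of `v`. -/
noncomputable def inDeg (D : Digraph V) (v : V) : ℕ := {u | D.Adj u v}.ncard

/-- An Eulerian digraph: in-degree and out-degree agree at every vertex.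
Connectedness is not required. -/
def IsEulerian (D : Digraph V) : Prop := ∀ v, outDeg D v = inDeg D v

/-- A symmetric digraph: the reverse of every arc is an arc. -/
def IsSymmetric (D : Digraph V) : Prop := ∀ u v, D.Adj u v → D.Adj v u

/-- A directed path of `D` from `x` to `y`, given by its list of (distinct) vertices. -/
def IsPath (D : Digraph V) (x y : V) (p : List V) : Prop :=
  p.head? = some x ∧ p.getLast? = some y ∧ p.Nodup ∧ p.IsChain D.Adj

/-- The arcs of a path: the pairs of consecutive vertices. -/
def pathArcs (p : List V) : Set (V × V) := {a | a ∈ p.zip p.tail}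

/-- The maximum number of pairwise arc-disjoint directed `(x, y)`-paths in `D`. -/
noncomputable def arcConn (D : Digraph V) (x y : V) : ℕ∞ :=
  ⨆ (k : ℕ) (_ : ∃ P : Fin k → List V, (∀ i, IsPath D x y (P i)) ∧
    ∀ i j, i ≠ j → Disjoint (pathArcs (P i)) (pathArcs (P j))), (k : ℕ∞)

/-- An out-tree of `D` rooted at `r`: an oriented tree contained in `D` in which every vertex
except the root has in-degree one (and the root has in-degree zero). -/
structure OutTree (D : Digraph V) (r : V) where
  /-- the vertices -/
  verts : Set V
  /-- the arcs -/
  arcs : Set (V × V)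
  /-- the arcs are arcs of `D` -/
  adj_of_mem : ∀ u v, (u, v) ∈ arcs → D.Adj u v
  /-- the ends of the arcs are vertices of the tree -/
  ends_mem : ∀ u v, (u, v) ∈ arcs → u ∈ verts ∧ v ∈ verts
  /-- no loops and no pairs of opposite arcs -/
  oriented : ∀ u v, (u, v) ∈ arcs → (v, u) ∉ arcs
  /-- the underlying undirected graph is a tree -/
  isTree : ((SimpleGraph.fromRel fun u v => (u, v) ∈ arcs).induce verts).IsTree
  /-- the root is a vertex -/
  root_mem : r ∈ verts
  /-- the root has in-degree zero -/
  root_indeg : ∀ u, (u, r) ∉ arcs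
  /-- every other vertex has in-degree one -/
  indeg : ∀ v ∈ verts, v ≠ r → ∃! u, (u, v) ∈ arcs

/-- The maximum number of pairwise arc-disjoint `(S, r)`-trees in `D`, an `(S, r)`-tree being
an out-tree rooted at `r` that contains all vertices of `S`. -/
noncomputable def treeConn (D : Digraph V) (S : Finset V) (r : V) : ℕ∞ :=
  ⨆ (k : ℕ) (_ : ∃ T : Fin k → OutTree D r, (∀ i, (S : Set V) ⊆ (T i).verts) ∧
    ∀ i j, i ≠ j → Disjoint (T i).arcs (T j).arcs), (k : ℕ∞)

end DiTree

/-! ## A random access machine and polynomial time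

A RAM with natural-number registers and memory arrays, indirect addressing, addition and
truncated subtraction. Every instruction and every test costs one step. There is
no multiplication, so numbers have at most linearly many bits in the number of steps and of input
bits, and polynomial time on this machine is polynomial time on a Turing machine. -/

namespace RAM

/-- The memory: registers `reg x`, and cells `arr a i` of the array `a`. -/
structure Store where
  /-- registers -/
  reg : ℕ → ℕ
  /-- arrays -/
  arr : ℕ → ℕ → ℕ

/-- The instructions. -/
inductive Instr where
  /-- `x := c` -/
  | const (x c : ℕ)
  /-- `x := y` -/
  | copy (x y : ℕ)
  /-- `x := y + z` -/
  | add (x y z : ℕ)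
  /-- `x := max (y - z) 0` -/
  | sub (x y z : ℕ)
  /-- `x := a[y]` -/
  | load (x a y : ℕ)
  /-- `a[x] := y` -/
  | store (a x y : ℕ)

/-- Assign the value `c` to register `x`. -/
def Store.setReg (σ : Store) (x c : ℕ) : Store :=
  { σ with reg := Function.update σ.reg x c }

/-- The effect of an instruction. -/
def Instr.exec : Instr → Store → Store
  | .const x c, σ => σ.setReg x c
  | .copy x y, σ => σ.setReg x (σ.reg y)
  | .add x y z, σ => σ.setReg x (σ.reg y + σ.reg z)
  | .sub x y z, σ => σ.setReg x (σ.reg y - σ.reg z)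
  | .load x a y, σ => σ.setReg x (σ.arr a (σ.reg y))
  | .store a x y, σ =>
      { σ with arr := Function.update σ.arr a (Function.update (σ.arr a) (σ.reg x) (σ.reg y)) }

/-- Programs. -/
inductive Prog where
  /-- a single instruction -/
  | instr (i : Instr)
  /-- first `P`, then `Q` -/
  | seq (P Q : Prog)
  /-- if register `x` is nonzero then `P` else `Q` -/
  | cond (x : ℕ) (P Q : Prog)
  /-- while register `x` is nonzero do `P` -/
  | loop (x : ℕ) (P : Prog)

/-- `Runs P σ τ t`: started on the memory `σ`, the program `P` halts after exactly `t` steps with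
the memory `τ`. -/
inductive Runs : Prog → Store → Store → ℕ → Prop where
  | instr (i : Instr) (σ : Store) : Runs (.instr i) σ (i.exec σ) 1
  | seq {P Q : Prog} {σ τ υ : Store} {s t : ℕ} :
      Runs P σ τ s → Runs Q τ υ t → Runs (.seq P Q) σ υ (s + t)
  | cond_true {x : ℕ} {P Q : Prog} {σ τ : Store} {t : ℕ} :
      σ.reg x ≠ 0 → Runs P σ τ t → Runs (.cond x P Q) σ τ (t + 1)
  | cond_false {x : ℕ} {P Q : Prog} {σ τ : Store} {t : ℕ} :
      σ.reg x = 0 → Runs Q σ τ t → Runs (.cond x P Q) σ τ (t + 1)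
  | loop_done {x : ℕ} {P : Prog} {σ : Store} :
      σ.reg x = 0 → Runs (.loop x P) σ σ 1
  | loop_step {x : ℕ} {P : Prog} {σ τ υ : Store} {s t : ℕ} :
      σ.reg x ≠ 0 → Runs P σ τ s → Runs (.loop x P) τ υ t → Runs (.loop x P) σ υ (s + t + 1)

/-- The initial memory on an input word: its length is in register `0`, its bits are in the
array `0`, and all else is `0`. -/
def initial (w : List Bool) : Store where
  reg := fun x => if x = 0 then w.length else 0
  arr := fun a i => if a = 0 then (w.getD i false).toNat else 0

/-- The problem "does `x` satisfy `Q`?", for inputs `x` in `dom` encoded by words `enc x`, is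
decidable in polynomial time: one program, on every such input, halts within a number of steps
polynomial in the length of the word, and leaves the answer `1` (yes) or `0` (no) in
register `0`. -/
def PolyTimeDecidable {α : Type*} (enc : α → List Bool) (dom Q : α → Prop) : Prop :=
  ∃ (P : Prog) (p : Polynomial ℕ), ∀ x, dom x → ∃ (τ : Store) (t : ℕ),
    Runs P (initial (enc x)) τ t ∧ t ≤ p.eval (enc x).length ∧
      ((Q x ∧ τ.reg 0 = 1) ∨ (¬ Q x ∧ τ.reg 0 = 0))

end RAM

/-! ## The decision problem -/

namespace DiTree

/-- An input `(D, S, r, ℓ)`, where `D` has the vertex set `{0, …, n - 1}`. -/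
structure Input where
  /-- the number of vertices -/
  n : ℕ
  /-- the digraph -/
  D : Digraph (Fin n)
  /-- the set of terminals -/
  S : Finset (Fin n)
  /-- the root -/
  r : Fin n
  /-- the threshold -/
  ℓ : ℕ

/-- `D` has no loops, `r ∈ S` and `|S| ≥ 2`. -/
def Input.Valid (I : Input) : Prop := Loopless I.D ∧ I.r ∈ I.S ∧ 2 ≤ I.S.card

open Classical in
/-- The encoding of an input as a binary word: `n` in unary, ended by a `0`; the adjacency matrix,
row by row; the characteristic vector of `S`; `r` in unary, ended by a `0`; and `ℓ` in binary,
least significant bit first. -/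
noncomputable def Input.encode (I : Input) : List Bool :=
  List.replicate I.n true ++ [false] ++
  ((List.finRange I.n).flatMap fun u => (List.finRange I.n).map fun v => decide (I.D.Adj u v)) ++
  ((List.finRange I.n).map fun v => decide (v ∈ I.S)) ++
  List.replicate I.r true ++ [false] ++
  Nat.bits I.ℓ

end DiTree

/-! ## Cuts of multi-digraphs -/

namespace DiTree

/-! Arc-disjoint (S, r)-trees contain arc-disjoint paths from r to each terminal, and ℓ arc-disjoint
paths from r to s force ℓ arcs into every set that contains s and misses r. The content is the
return from cuts to trees (`hasPacking_of_balanced`, `le_treeConn_of_cuts`). It closes the circle,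
so Menger's theorem is not needed.

If no arc enters S from outside, this return is Edmonds' theorem on arborescences in the subgraph
induced by S (`hasPacking_of_closed`, by Lovász's argument). Otherwise take an arc (v, w) with v
outside S and w in S. Balance of in- and out-degrees and an uncrossing argument give an arc (u, v)
such that replacing (u, v), (v, w) by (u, w) keeps every relevant cut at least ℓ (`exists_split`).
The new multi-digraph is again balanced and has one arc fewer. A packing in it lifts by replacing
(u, w) by the path u, v, w (`HasPacking.of_split`). Splitting may create parallel arcs and loops,
hence the multisets. The parts of the final packing are only required to reach S from r;
`exists_outTree` extracts out-trees.

For the algorithm, `le_treeConn_iff_cuts` reduces the question to a minimum cut between r and each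
terminal t, found by augmenting paths. No flow is represented: the invariant is that in the residual
capacities all cuts between r and t have lost the same amount. Once one of them is 0, that amount is
the minimum (`Net.eval_minCut`). All loops of the program run exactly as often as the input word is
long, so a fixed nesting of loops takes polynomial time (`Code.runs_compile`). Symmetric digraphs
are Eulerian, so the same program serves them. -/

/-- The number of arcs of the multi-digraph `M` that enter `X`. -/
def entering {V : Type*} [DecidableEq V] (M : Multiset (V × V)) (X : Finset V) : ℕ :=
  M.countP fun a => a.1 ∉ X ∧ a.2 ∈ X

/-- The number of arcs of the multi-digraph `M` that leave `X`. -/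
def leaving {V : Type*} [DecidableEq V] (M : Multiset (V × V)) (X : Finset V) : ℕ :=
  M.countP fun a => a.1 ∈ X ∧ a.2 ∉ X

/-- `M` contains `ℓ` pairwise arc-disjoint subgraphs, in each of which all vertices of `S` can be
reached from `r`. -/
def HasPacking {V : Type*} (M : Multiset (V × V)) (S : Finset V) (r : V) (ℓ : ℕ) : Prop :=
  ∃ f : Fin ℓ → Multiset (V × V), ∑ i, f i ≤ M ∧
    ∀ i, ∀ s ∈ S, Relation.ReflTransGen (fun a b => (a, b) ∈ f i) r s

/-! ### Uncrossing inequalities for cuts -/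

section Cuts

variable {V : Type*} [DecidableEq V]

theorem entering_zero (X : Finset V) : entering 0 X = 0 := by simp [entering]

theorem leaving_zero (X : Finset V) : leaving 0 X = 0 := by simp [leaving]

theorem entering_cons (a : V × V) (M : Multiset (V × V)) (X : Finset V) :
    entering (a ::ₘ M) X = entering M X + if a.1 ∉ X ∧ a.2 ∈ X then 1 else 0 := by
  simp [entering, Multiset.countP_cons]

theorem leaving_cons (a : V × V) (M : Multiset (V × V)) (X : Finset V) :
    leaving (a ::ₘ M) X = leaving M X + if a.1 ∈ X ∧ a.2 ∉ X then 1 else 0 := by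
  simp [leaving, Multiset.countP_cons]

theorem entering_add (M N : Multiset (V × V)) (X : Finset V) :
    entering (M + N) X = entering M X + entering N X := by
  simp [entering, Multiset.countP_add]

theorem exists_mem_of_entering_pos {M : Multiset (V × V)} {X : Finset V}
    (h : 0 < entering M X) : ∃ a ∈ M, a.1 ∉ X ∧ a.2 ∈ X := Multiset.countP_pos.1 h

/-- Submodularity; only arcs between `X \ Y` and `Y \ X` make it strict. -/
theorem entering_inter_add_union (M : Multiset (V × V)) (X Y : Finset V) :
    entering M (X ∩ Y) + entering M (X ∪ Y) ≤ entering M X + entering M Y := by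
  induction M using Multiset.induction_on with
  | empty => simp [entering_zero]
  | cons a M ih =>
    simp only [entering_cons, Finset.mem_inter, Finset.mem_union]
    by_cases h1 : a.1 ∈ X <;> by_cases h2 : a.2 ∈ X <;> by_cases h3 : a.1 ∈ Y <;>
      by_cases h4 : a.2 ∈ Y <;> simp [h1, h2, h3, h4] <;> omega

/-- Submodularity for `X` and the complement of `Y`, written without complements. -/
theorem entering_sdiff_add_leaving_sdiff (M : Multiset (V × V)) (X Y : Finset V) :
    entering M (X \ Y) + leaving M (Y \ X) ≤ entering M X + leaving M Y := by
  induction M using Multiset.induction_on with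
  | empty => simp [entering_zero, leaving_zero]
  | cons a M ih =>
    simp only [entering_cons, leaving_cons, Finset.mem_sdiff]
    by_cases h1 : a.1 ∈ X <;> by_cases h2 : a.2 ∈ X <;> by_cases h3 : a.1 ∈ Y <;>
      by_cases h4 : a.2 ∈ Y <;> simp [h1, h2, h3, h4] <;> omega

/-! ### Packing spanning arborescences: Edmonds' theorem -/

/-- An arborescence on `U` with arcs `F` can be extended by an arc of `N` such that the cuts of
the rest remain large. -/
theorem exists_extending_arc {S U : Finset V} {r : V} {F N : Multiset (V × V)} {ℓ : ℕ}
    (hclosed : ∀ a ∈ N, a.2 ∈ S → a.1 ∈ S)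
    (hM : ∀ X ⊆ S, r ∉ X → X.Nonempty → ℓ + 1 ≤ entering (F + N) X)
    (hN : ∀ X ⊆ S, r ∉ X → X.Nonempty → ℓ ≤ entering N X)
    (hF : ∀ a ∈ F, a.2 ∈ U) (hr : r ∈ U) (hU : U ⊂ S) :
    ∃ a ∈ N, a.1 ∈ U ∧ a.2 ∈ S ∧ a.2 ∉ U ∧
      ∀ X ⊆ S, r ∉ X → X.Nonempty → ℓ ≤ entering (N.erase a) X := by
  have hFX : ∀ X : Finset V, entering F (X \ U) = 0 := by
    intro X
    by_contra h
    obtain ⟨a, ha, -, h2⟩ := exists_mem_of_entering_pos (Nat.pos_of_ne_zero h)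
    exact (Finset.mem_sdiff.1 h2).2 (hF a ha)
  -- All heads of `F` lie in `U`, so the arcs that enter `X \ U` all belong to `N`.
  have hNX : ∀ X ⊆ S, (X \ U).Nonempty → ℓ + 1 ≤ entering N (X \ U) := by
    intro X hX hne
    have := hM (X \ U) (Finset.sdiff_subset.trans hX) (by simp [hr]) hne
    rwa [entering_add, hFX, zero_add] at this
  have erase_ok : ∀ a ∈ N, (∀ X ⊆ S, r ∉ X → X.Nonempty → a.1 ∉ X → a.2 ∈ X →
      ℓ + 1 ≤ entering N X) → ∀ X ⊆ S, r ∉ X → X.Nonempty → ℓ ≤ entering (N.erase a) X := by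
    intro a ha h X hX hrX hne
    have e := entering_cons a (N.erase a) X
    rw [Multiset.cons_erase ha] at e
    have h1 := hN X hX hrX hne
    split_ifs at e with hc
    · have := h X hX hrX hne hc.1 hc.2
      omega
    · omega
  -- Deleting an arc does harm only if it enters a set with exactly `ℓ` entering arcs; as its head
  -- is outside `U`, only sets that stick out of `U` matter.
  let tight : Finset (Finset V) := S.powerset.filter fun X =>
    r ∉ X ∧ (X \ U).Nonempty ∧ entering N X = ℓ
  by_cases ht : tight.Nonempty
  -- For a minimal tight `X`, more arcs enter `X \ U` than `X`, so one of them starts in `X ∩ U`. If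
  -- its deletion harmed `Y`, then `X ∩ Y` would be tight by submodularity, and smaller, since it
  -- misses the tail.
  · obtain ⟨X, hX, hmin⟩ := Finset.exists_min_image tight Finset.card ht
    simp only [tight, Finset.mem_filter, Finset.mem_powerset] at hX hmin
    obtain ⟨hXS, hrX, hXU, hXe⟩ := hX
    have hlt : entering N X < entering N (X \ U) := by
      have := hNX X hXS hXU
      omega
    obtain ⟨a, haN, ha1, ha2, ha3⟩ : ∃ a ∈ N, a.1 ∈ X \ (X \ U) ∧ a.2 ∈ X ∧ a.2 ∉ U := by
      by_contra hcon
      push Not at hcon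
      refine absurd hlt (not_lt.2 ?_)
      unfold entering
      rw [Multiset.countP_eq_card_filter, Multiset.countP_eq_card_filter]
      apply Multiset.card_le_card
      rw [Multiset.le_filter]
      refine ⟨Multiset.filter_le _ _, fun a ha => ?_⟩
      rw [Multiset.mem_filter] at ha
      have := hcon a ha.1
      simp only [Finset.mem_sdiff] at this ha
      tauto
    have ha1' : a.1 ∈ X ∧ a.1 ∈ U := by
      simp only [Finset.mem_sdiff] at ha1
      tauto
    refine ⟨a, haN, ha1'.2, hXS ha2, ha3, erase_ok a haN ?_⟩
    intro Y hYS hrY hYne h1 h2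
    by_contra hY
    have hYe : entering N Y = ℓ := le_antisymm (by omega) (hN Y hYS hrY hYne)
    have hsub := entering_inter_add_union N X Y
    have hi := hN (X ∩ Y) (Finset.inter_subset_left.trans hXS) (by simp [hrX])
      ⟨a.2, by simp [ha2, h2]⟩
    have hu := hN (X ∪ Y) (Finset.union_subset hXS hYS) (by simp [hrX, hrY]) ⟨a.2, by simp [ha2]⟩
    have hcard := hmin (X ∩ Y) ⟨Finset.inter_subset_left.trans hXS, by simp [hrX],
      ⟨a.2, by simp [ha2, h2, ha3]⟩, by omega⟩
    have : X ∩ Y ⊂ X := (Finset.ssubset_iff_of_subset Finset.inter_subset_left).2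
      ⟨a.1, ha1'.1, by simp [h1]⟩
    exact absurd (Finset.card_lt_card this) (not_lt.2 hcard)
  -- Without tight sets every arc from `U` to `S \ U` will do; `hclosed` keeps the tail inside `S`.
  · have hSU : (S \ U).Nonempty := Finset.sdiff_nonempty.2 hU.2
    obtain ⟨a, haN, h1, h2⟩ := exists_mem_of_entering_pos
      (lt_of_lt_of_le (Nat.succ_pos ℓ) (hNX S subset_rfl hSU))
    rw [Finset.mem_sdiff] at h1 h2
    have haU : a.1 ∈ U := by
      by_contra h
      exact h1 ⟨hclosed a haN h2.1, h⟩
    refine ⟨a, haN, haU, h2.1, h2.2, erase_ok a haN ?_⟩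
    intro X hXS hrX hne _ h2'
    by_contra hX
    refine ht ⟨X, ?_⟩
    simp only [tight, Finset.mem_filter, Finset.mem_powerset]
    exact ⟨hXS, hrX, ⟨a.2, by simp [h2', h2.2]⟩, le_antisymm (by omega) (hN X hXS hrX hne)⟩

/-- Peels off one spanning part at the price of one unit of each cut. The part grows from `{r}` by
one vertex at a time, and `N` retains cuts of size `ℓ` throughout. -/
theorem exists_spanning_of_cuts {S : Finset V} {r : V} {ℓ : ℕ} {M : Multiset (V × V)}
    (hr : r ∈ S) (hclosed : ∀ a ∈ M, a.2 ∈ S → a.1 ∈ S)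
    (hM : ∀ X ⊆ S, r ∉ X → X.Nonempty → ℓ + 1 ≤ entering M X) :
    ∃ F N : Multiset (V × V), F + N = M ∧
      (∀ s ∈ S, Relation.ReflTransGen (fun a b => (a, b) ∈ F) r s) ∧
      ∀ X ⊆ S, r ∉ X → X.Nonempty → ℓ ≤ entering N X := by
  suffices H : ∀ (m : ℕ) (U : Finset V) (F N : Multiset (V × V)), (S \ U).card = m → U ⊆ S →
      r ∈ U → F + N = M → (∀ a ∈ F, a.2 ∈ U) →
      (∀ s ∈ U, Relation.ReflTransGen (fun a b => (a, b) ∈ F) r s) →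
      (∀ X ⊆ S, r ∉ X → X.Nonempty → ℓ ≤ entering N X) →
      ∃ F N : Multiset (V × V), F + N = M ∧
      (∀ s ∈ S, Relation.ReflTransGen (fun a b => (a, b) ∈ F) r s) ∧
      ∀ X ⊆ S, r ∉ X → X.Nonempty → ℓ ≤ entering N X by
    refine H _ {r} 0 M rfl (by simpa using hr) (by simp) (by simp) (by simp) ?_ ?_
    · intro s hs
      rw [Finset.mem_singleton.1 hs]
    · intro X h1 h2 h3
      exact (Nat.le_succ _).trans (hM X h1 h2 h3)
  intro m
  induction m with
  | zero =>
    intro U F N hm hUS hrU hFN hF hreach hN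
    have : S ⊆ U := by simpa [Finset.sdiff_eq_empty_iff_subset] using hm
    exact ⟨F, N, hFN, fun s hs => hreach s (this hs), hN⟩
  | succ m ih =>
    intro U F N hm hUS hrU hFN hF hreach hN
    have hss : U ⊂ S := by
      refine ⟨hUS, fun h => ?_⟩
      rw [Finset.sdiff_eq_empty_iff_subset.2 h] at hm
      simp at hm
    obtain ⟨a, haN, ha1, ha2, ha3, hcut⟩ := exists_extending_arc (F := F) (N := N)
      (fun a ha => hclosed a (hFN ▸ Multiset.mem_add.2 (.inr ha))) (hFN ▸ hM) hN hF hrU hss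
    refine ih (insert a.2 U) (a ::ₘ F) (N.erase a) ?_ ?_ ?_ ?_ ?_ ?_ hcut
    · have : S \ U = insert a.2 (S \ insert a.2 U) := by
        ext x
        simp only [Finset.mem_sdiff, Finset.mem_insert]
        by_cases hx : x = a.2
        · simp [hx, ha2, ha3]
        · simp [hx]
      rw [this, Finset.card_insert_of_notMem (by simp)] at hm
      omega
    · exact Finset.insert_subset ha2 hUS
    · simp [hrU]
    · rw [← hFN, Multiset.cons_add, ← Multiset.add_cons, Multiset.cons_erase haN]
    · intro b hb
      rcases Multiset.mem_cons.1 hb with rfl | hb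
      · simp
      · simp [hF b hb]
    · have mono : ∀ s ∈ U, Relation.ReflTransGen (fun x y => (x, y) ∈ a ::ₘ F) r s := fun s hs =>
        Relation.ReflTransGen.mono (fun x y h => Multiset.mem_cons_of_mem h) _ _ (hreach s hs)
      intro s hs
      rcases Finset.mem_insert.1 hs with rfl | hs
      · exact (mono _ ha1).tail (Multiset.mem_cons_self _ _)
      · exact mono s hs

/-- Edmonds' theorem for the subgraph induced by `S`, into which no arc of `M` enters. -/
theorem hasPacking_of_closed {S : Finset V} {r : V} (hr : r ∈ S) (ℓ : ℕ) :
    ∀ M : Multiset (V × V), (∀ a ∈ M, a.2 ∈ S → a.1 ∈ S) →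
    (∀ X ⊆ S, r ∉ X → X.Nonempty → ℓ ≤ entering M X) → HasPacking M S r ℓ := by
  induction ℓ with
  | zero => exact fun M _ _ => ⟨fun _ => 0, by simp, fun i => i.elim0⟩
  | succ ℓ ih =>
    intro M hclosed hM
    obtain ⟨F, N, rfl, hF, hN⟩ := exists_spanning_of_cuts hr hclosed hM
    obtain ⟨f, hf, hreach⟩ := ih N (fun a ha => hclosed a (Multiset.mem_add.2 (.inr ha))) hN
    refine ⟨Fin.cons F f, ?_, ?_⟩
    · rw [Fin.sum_univ_succ]
      simpa using hf
    · intro i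
      refine Fin.cases ?_ (fun i => ?_) i
      · simpa using hF
      · simpa using hreach i

end Cuts

end DiTree

namespace DiTree

section Splitting

variable {V : Type*} [DecidableEq V]

/-! ### Splitting off in Eulerian multi-digraphs -/

/-- Removing `v` from `X` loses all non-loop arcs into `v`, since they come from outside `X`, and
gains only arcs from `v` into `X`. The arc `(v, w)` is not among the latter, which gives the `+ 1`.
-/
theorem entering_erase_vertex {M : Multiset (V × V)} {X : Finset V} {v w : V} (hv : v ∈ X)
    (hw : w ∉ X) (hM : ∀ a ∈ (v, w) ::ₘ M, a.2 = v → a.1 ∉ X ∨ a.1 = v) :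
    entering ((v, w) ::ₘ M) (X.erase v) + entering ((v, w) ::ₘ M) {v} + 1 ≤
      entering ((v, w) ::ₘ M) X + leaving ((v, w) ::ₘ M) {v} := by
  have key : entering M (X.erase v) + entering M {v} ≤ entering M X + leaving M {v} := by
    have hM' : ∀ a ∈ M, a.2 = v → a.1 ∉ X ∨ a.1 = v := fun a ha =>
      hM a (Multiset.mem_cons_of_mem ha)
    clear hM
    induction M using Multiset.induction_on with
    | empty => simp [entering_zero, leaving_zero]
    | cons a M ih =>
      have h := hM' a (Multiset.mem_cons_self _ _)
      have ih := ih fun b hb => hM' b (Multiset.mem_cons_of_mem hb)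
      simp only [entering_cons, leaving_cons, Finset.mem_erase, Finset.mem_singleton]
      by_cases h1 : a.1 = v
      · by_cases h2 : a.2 = v
        · simp [h1, h2, hv]; omega
        · by_cases h3 : a.2 ∈ X <;> simp [h1, h2, hv, h3] <;> omega
      · by_cases h2 : a.2 = v
        · have h4 : a.1 ∉ X := by tauto
          simp [h1, h2, hv, h4]; omega
        · by_cases h3 : a.2 ∈ X <;> by_cases h4 : a.1 ∈ X <;> simp [h1, h2, h3, h4] <;> omega
  have hwv : w ≠ v := fun h => hw (h ▸ hv)
  simp only [entering_cons, leaving_cons, Finset.mem_erase, Finset.mem_singleton]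
  simp [hv, hw, hwv]
  omega

/-- Adding `v` creates no entering arc, and `(v, w)` ceases to be one. -/
theorem entering_insert_vertex {M : Multiset (V × V)} {Y : Finset V} {v w : V} (hv : v ∉ Y)
    (hw : w ∈ Y) (hM : ∀ a ∈ (v, w) ::ₘ M, a.2 = v → a.1 ∈ Y ∨ a.1 = v) :
    entering ((v, w) ::ₘ M) (insert v Y) + 1 ≤ entering ((v, w) ::ₘ M) Y := by
  have key : entering M (insert v Y) ≤ entering M Y := by
    have hM' : ∀ a ∈ M, a.2 = v → a.1 ∈ Y ∨ a.1 = v := fun a ha =>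
      hM a (Multiset.mem_cons_of_mem ha)
    clear hM
    induction M using Multiset.induction_on with
    | empty => simp [entering_zero]
    | cons a M ih =>
      have h := hM' a (Multiset.mem_cons_self _ _)
      have ih := ih fun b hb => hM' b (Multiset.mem_cons_of_mem hb)
      simp only [entering_cons, Finset.mem_insert]
      by_cases h2 : a.2 = v
      · rcases h h2 with h1 | h1 <;> simp [h1, h2, hv] <;> omega
      · by_cases h3 : a.2 ∈ Y <;> by_cases h4 : a.1 ∈ Y <;> by_cases h1 : a.1 = v <;>
          simp [h1, h2, h3, h4] <;> omega
  simp only [entering_cons, Finset.mem_insert]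
  simp [hv, hw]
  omega

theorem balanced_split {M : Multiset (V × V)} {u v w : V}
    (h : ∀ X, entering ((v, w) ::ₘ (u, v) ::ₘ M) X = leaving ((v, w) ::ₘ (u, v) ::ₘ M) X)
    (X : Finset V) : entering ((u, w) ::ₘ M) X = leaving ((u, w) ::ₘ M) X := by
  have := h X
  simp only [entering_cons, leaving_cons] at this ⊢
  by_cases h1 : u ∈ X <;> by_cases h2 : v ∈ X <;> by_cases h3 : w ∈ X <;>
    simp [h1, h2, h3] at this ⊢ <;> omega

/-- Every arc `(v, w)` with `v ∉ S` can be split off together with some arc `(u, v)`. -/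
theorem exists_split [Fintype V] {S : Finset V} {r v w : V} {ℓ : ℕ} {M : Multiset (V × V)}
    (hr : r ∈ S) (hv : v ∉ S) (hvw : w ≠ v)
    (hbal : ∀ X, entering ((v, w) ::ₘ M) X = leaving ((v, w) ::ₘ M) X)
    (hcut : ∀ X : Finset V, r ∉ X → (X ∩ S).Nonempty → ℓ ≤ entering ((v, w) ::ₘ M) X) :
    ∃ u, (u, v) ∈ M ∧ ∀ X : Finset V, r ∉ X → (X ∩ S).Nonempty →
      ℓ ≤ entering ((u, w) ::ₘ M.erase (u, v)) X := by
  by_contra hcon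
  push Not at hcon
  -- Splitting off lowers the cut of `X` in two cases only: `v ∈ X` and `u, w ∉ X`, or `v ∉ X` and
  -- `u, w ∈ X`. `A` and `B` collect the cuts of size exactly `ℓ` that can obstruct in these two
  -- ways.
  let A : Finset (Finset V) := Finset.univ.filter fun X => r ∉ X ∧ (X ∩ S).Nonempty ∧
    entering ((v, w) ::ₘ M) X = ℓ ∧ v ∈ X ∧ w ∉ X
  let B : Finset (Finset V) := Finset.univ.filter fun X => r ∉ X ∧ (X ∩ S).Nonempty ∧
    entering ((v, w) ::ₘ M) X = ℓ ∧ v ∉ X ∧ w ∈ X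
  have memA : ∀ X, X ∈ A ↔ r ∉ X ∧ (X ∩ S).Nonempty ∧
    entering ((v, w) ::ₘ M) X = ℓ ∧ v ∈ X ∧ w ∉ X := fun X => by simp [A]
  have memB : ∀ X, X ∈ B ↔ r ∉ X ∧ (X ∩ S).Nonempty ∧
    entering ((v, w) ::ₘ M) X = ℓ ∧ v ∉ X ∧ w ∈ X := fun X => by simp [B]
  have blocked : ∀ u, (u, v) ∈ M → (∃ X ∈ A, u ∉ X) ∨ (∃ X ∈ B, u ∈ X) := by
    intro u hu
    obtain ⟨X, hrX, hXS, hX⟩ := hcon u hu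
    have h1 := hcut X hrX hXS
    have h2 := h1
    rw [← Multiset.cons_erase hu] at h2
    simp only [entering_cons] at hX h2
    by_cases huX : u ∈ X <;> by_cases hvX : v ∈ X <;> by_cases hwX : w ∈ X <;>
      simp [huX, hvX, hwX] at hX h2 <;> try omega
    · refine .inr ⟨X, (memB X).2 ⟨hrX, hXS, ?_, hvX, hwX⟩, huX⟩
      refine le_antisymm ?_ h1
      rw [← Multiset.cons_erase hu]
      simp [entering_cons, huX, hvX, hwX]
      omega
    · refine .inl ⟨X, (memA X).2 ⟨hrX, hXS, ?_, hvX, hwX⟩, huX⟩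
      refine le_antisymm ?_ h1
      rw [← Multiset.cons_erase hu]
      simp [entering_cons, huX, hvX, hwX]
      omega
  -- If `X` and `Y` share no terminal, both differences still contain terminals. Balance turns the
  -- entering count of `Y \ X` into a leaving count, ready for `entering_sdiff_add_leaving_sdiff`.
  have cross : ∀ X Y : Finset V, ((X ∩ Y) ∩ S) = ∅ → (X ∩ S).Nonempty → (Y ∩ S).Nonempty →
      r ∉ X → r ∉ Y → ℓ ≤ entering ((v, w) ::ₘ M) (X \ Y) ∧ ℓ ≤ leaving ((v, w) ::ₘ M) (Y \ X) := by
    intro X Y hd hX hY hrX hrY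
    rw [← hbal]
    refine ⟨hcut _ (by simp [hrX]) ?_, hcut _ (by simp [hrY]) ?_⟩
    · obtain ⟨x, hx⟩ := hX
      have : x ∉ (X ∩ Y) ∩ S := by simp [hd]
      exact ⟨x, by simp only [Finset.mem_inter, Finset.mem_sdiff] at *; tauto⟩
    · obtain ⟨x, hx⟩ := hY
      have : x ∉ (X ∩ Y) ∩ S := by simp [hd]
      exact ⟨x, by simp only [Finset.mem_inter, Finset.mem_sdiff] at *; tauto⟩
  have hunion : ∀ X Y : Finset V, (X ∩ S).Nonempty → ((X ∪ Y) ∩ S).Nonempty := fun X Y h =>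
    h.mono (Finset.inter_subset_inter_right Finset.subset_union_left)
  have hAA : ∀ X ∈ A, ∀ Y ∈ A, X ∩ Y ∈ A := by
    intro X hX Y hY
    rw [memA] at *
    obtain ⟨hrX, hXS, hXe, hvX, hwX⟩ := hX
    obtain ⟨hrY, hYS, hYe, hvY, hwY⟩ := hY
    rcases Finset.eq_empty_or_nonempty ((X ∩ Y) ∩ S) with hd | hd
    -- Impossible: `(v, w)` leaves both sets but neither difference, so the inequality for `M`
    -- without this arc is violated. The sets thus share a terminal, and submodularity applies.
    · obtain ⟨h1, h2⟩ := cross X Y hd hXS hYS hrX hrY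
      have h3 := entering_sdiff_add_leaving_sdiff M X Y
      rw [hbal] at hYe
      simp only [entering_cons, leaving_cons] at h1 h2 hXe hYe
      simp [hvX, hwX, hvY, hwY] at h1 h2 hXe hYe
      omega
    · have h1 := hcut (X ∩ Y) (by simp [hrX]) hd
      have h2 := hcut (X ∪ Y) (by simp [hrX, hrY]) (hunion X Y hXS)
      have h3 := entering_inter_add_union ((v, w) ::ₘ M) X Y
      exact ⟨by simp [hrX], hd, by omega, by simp [hvX, hvY], by simp [hwX]⟩
  have hBB : ∀ X ∈ B, ∀ Y ∈ B, X ∪ Y ∈ B := by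
    intro X hX Y hY
    rw [memB] at *
    obtain ⟨hrX, hXS, hXe, hvX, hwX⟩ := hX
    obtain ⟨hrY, hYS, hYe, hvY, hwY⟩ := hY
    rcases Finset.eq_empty_or_nonempty ((X ∩ Y) ∩ S) with hd | hd
    · obtain ⟨h1, h2⟩ := cross X Y hd hXS hYS hrX hrY
      have h3 := entering_sdiff_add_leaving_sdiff M X Y
      rw [hbal] at hYe
      simp only [entering_cons, leaving_cons] at h1 h2 hXe hYe
      simp [hvX, hwX, hvY, hwY] at h1 h2 hXe hYe
      omega
    · have h1 := hcut (X ∩ Y) (by simp [hrX]) hd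
      have h2 := hcut (X ∪ Y) (by simp [hrX, hrY]) (hunion X Y hXS)
      have h3 := entering_inter_add_union ((v, w) ::ₘ M) X Y
      exact ⟨by simp [hrX, hrY], hunion X Y hXS, by omega, by simp [hvX, hvY], by simp [hwX]⟩
  have hAB : ∀ X ∈ A, ∀ Y ∈ B, X \ Y ∈ A := by
    intro X hX Y hY
    rw [memA] at *
    rw [memB] at hY
    obtain ⟨hrX, hXS, hXe, hvX, hwX⟩ := hX
    obtain ⟨hrY, hYS, hYe, hvY, hwY⟩ := hY
    rcases Finset.eq_empty_or_nonempty ((X ∩ Y) ∩ S) with hd | hd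
    · obtain ⟨h1, h2⟩ := cross X Y hd hXS hYS hrX hrY
      have h3 := entering_sdiff_add_leaving_sdiff ((v, w) ::ₘ M) X Y
      rw [hbal] at hYe
      have hne : ((X \ Y) ∩ S).Nonempty := by
        obtain ⟨x, hx⟩ := hXS
        have : x ∉ (X ∩ Y) ∩ S := by simp [hd]
        exact ⟨x, by simp only [Finset.mem_inter, Finset.mem_sdiff] at *; tauto⟩
      exact ⟨by simp [hrX], hne, by omega, by simp [hvX, hvY], by simp [hwX]⟩
    -- Here a common terminal is impossible: `(v, w)` enters `Y`, but neither `X ∩ Y` nor `X ∪ Y`,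
    -- so submodularity for `M` fails by at least one.
    · have h1 := hcut (X ∩ Y) (by simp [hrX]) hd
      have h2 := hcut (X ∪ Y) (by simp [hrX, hrY]) (hunion X Y hXS)
      have h3 := entering_inter_add_union M X Y
      simp only [entering_cons] at h1 h2 hXe hYe
      simp [hvX, hwX, hvY, hwY] at h1 h2 hXe hYe
      omega
  have memM : ∀ a ∈ (v, w) ::ₘ M, a.2 = v → (a.1, v) ∈ M := by
    intro a ha h2
    rcases Multiset.mem_cons.1 ha with rfl | ha
    · exact absurd h2 hvw
    · rwa [← h2]
  by_cases hA : A.Nonempty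
  -- By minimality, intersecting with a member of `A` or subtracting a member of `B` leaves `X`
  -- unchanged. Hence every `u` is outside `X`, and removing `v` yields a cut smaller than `ℓ`.
  · obtain ⟨X, hX, hmin⟩ := Finset.exists_min_image A Finset.card hA
    have hin : ∀ a ∈ (v, w) ::ₘ M, a.2 = v → a.1 ∉ X ∨ a.1 = v := by
      intro a ha h2
      left
      rcases blocked a.1 (memM a ha h2) with ⟨Z, hZ, haZ⟩ | ⟨Z, hZ, haZ⟩
      · have := Finset.eq_of_subset_of_card_le Finset.inter_subset_left (hmin _ (hAA X hX Z hZ))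
        rw [← this]
        simp [haZ]
      · have := Finset.eq_of_subset_of_card_le Finset.sdiff_subset (hmin _ (hAB X hX Z hZ))
        rw [← this]
        simp [haZ]
    obtain ⟨hrX, hXS, hXe, hvX, hwX⟩ := (memA X).1 hX
    have h1 := entering_erase_vertex hvX hwX hin
    have h2 := hcut (X.erase v) (by simp [hrX]) (by
      obtain ⟨x, hx⟩ := hXS
      rw [Finset.mem_inter] at hx
      have : x ≠ v := fun h => hv (h ▸ hx.2)
      exact ⟨x, by simp [hx, this]⟩)
    have h3 := hbal {v}
    omega
  -- With `A` empty, every `u` is blocked by `B`, hence lies in the maximal member `Y`; adding `v`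
  -- to `Y` yields a cut smaller than `ℓ`. Balance at `v` supplies at least one `u`.
  · have hB : B.Nonempty := by
      have h3 := hbal {v}
      have h4 : 0 < entering ((v, w) ::ₘ M) {v} := by
        rw [h3, leaving_cons]
        simp [hvw]
      obtain ⟨a, ha, h1, h2⟩ := exists_mem_of_entering_pos h4
      rcases blocked a.1 (memM a ha (by simpa using h2)) with ⟨Z, hZ, -⟩ | ⟨Z, hZ, -⟩
      · exact absurd ⟨Z, hZ⟩ hA
      · exact ⟨Z, hZ⟩
    obtain ⟨Y, hY, hmax⟩ := Finset.exists_max_image B Finset.card hB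
    have hin : ∀ a ∈ (v, w) ::ₘ M, a.2 = v → a.1 ∈ Y ∨ a.1 = v := by
      intro a ha h2
      left
      rcases blocked a.1 (memM a ha h2) with ⟨Z, hZ, haZ⟩ | ⟨Z, hZ, haZ⟩
      · exact absurd ⟨Z, hZ⟩ hA
      · have := Finset.eq_of_subset_of_card_le Finset.subset_union_left (hmax _ (hBB Y hY Z hZ))
        rw [this]
        simp [haZ]
    obtain ⟨hrY, hYS, hYe, hvY, hwY⟩ := (memB Y).1 hY
    have h1 := entering_insert_vertex hvY hwY hin
    have h2 := hcut (insert v Y) (by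
        have : r ≠ v := fun h => hv (h ▸ hr)
        simp [hrY, this])
      (hYS.mono (Finset.inter_subset_inter_right (Finset.subset_insert _ _)))
    omega

/-- A packing lifts along the inverse of a splitting operation. -/
theorem HasPacking.of_split {S : Finset V} {r u v w : V} {ℓ : ℕ} {M : Multiset (V × V)}
    (h : HasPacking ((u, w) ::ₘ M) S r ℓ) : HasPacking ((v, w) ::ₘ (u, v) ::ₘ M) S r ℓ := by
  obtain ⟨f, hf, hreach⟩ := h
  -- `M` may contain further copies of `(u, w)`; only if these do not suffice must one copy be
  -- replaced by the path through `v`.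
  by_cases hle : ∑ i, f i ≤ M
  · exact ⟨f, hle.trans ((Multiset.le_cons_self _ _).trans (Multiset.le_cons_self _ _)), hreach⟩
  obtain ⟨i, hi⟩ : ∃ i, (u, w) ∈ f i := by
    by_contra hcon
    push Not at hcon
    refine hle ((Multiset.le_cons_of_notMem ?_).1 hf)
    simpa [Multiset.mem_sum] using hcon
  refine ⟨Function.update f i ((v, w) ::ₘ (u, v) ::ₘ (f i).erase (u, w)), ?_, ?_⟩
  · rw [← Finset.add_sum_erase _ _ (Finset.mem_univ i)] at hf ⊢
    rw [← Multiset.cons_erase hi, Multiset.cons_add, Multiset.cons_le_cons_iff] at hf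
    rw [Function.update_self, Multiset.cons_add, Multiset.cons_add, Multiset.cons_le_cons_iff,
      Multiset.cons_le_cons_iff]
    convert hf using 2
    refine Finset.sum_congr rfl fun j hj => ?_
    rw [Function.update_of_ne (Finset.ne_of_mem_erase hj)]
  · intro j s hs
    by_cases hj : j = i
    · subst hj
      rw [Function.update_self]
      have := hreach j s hs
      clear hs
      induction this with
      | refl => rfl
      | @tail b c _ hbc ih =>
        by_cases hb : (b, c) = (u, w)
        · obtain ⟨rfl, rfl⟩ := Prod.mk.inj hb
          exact (ih.tail (b := b) (c := v) (by simp)).tail (by simp)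
        · exact ih.tail (by simp [Multiset.mem_erase_of_ne hb, hbc])
    · rw [Function.update_of_ne hj]
      exact hreach j s hs

/-- In a balanced multi-digraph, large cuts between `r` and the rest of `S` give a packing. -/
theorem hasPacking_of_balanced [Fintype V] {S : Finset V} {r : V} {ℓ : ℕ} (hr : r ∈ S) :
    ∀ M : Multiset (V × V), (∀ X, entering M X = leaving M X) →
    (∀ X : Finset V, r ∉ X → (X ∩ S).Nonempty → ℓ ≤ entering M X) → HasPacking M S r ℓ := by
  suffices H : ∀ (m : ℕ) (M : Multiset (V × V)), M.card = m →
      (∀ X, entering M X = leaving M X) →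
      (∀ X : Finset V, r ∉ X → (X ∩ S).Nonempty → ℓ ≤ entering M X) → HasPacking M S r ℓ from
    fun M => H _ M rfl
  intro m
  induction m using Nat.strong_induction_on with
  | _ m ih =>
    intro M hm hbal hcut
    by_cases hclosed : ∀ a ∈ M, a.2 ∈ S → a.1 ∈ S
    · refine hasPacking_of_closed hr ℓ M hclosed fun X hX hrX hne => hcut X hrX ?_
      rwa [Finset.inter_eq_left.2 hX]
    · push Not at hclosed
      obtain ⟨⟨v, w⟩, ha, hw, hv⟩ := hclosed
      obtain ⟨M, rfl⟩ := Multiset.exists_cons_of_mem ha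
      -- Only arcs that enter `S` are split off; arcs elsewhere are harmless in
      -- `hasPacking_of_closed`.
      obtain ⟨u, hu, hcut'⟩ := exists_split hr hv (fun h => hv (h ▸ hw)) hbal hcut
      obtain ⟨M, rfl⟩ := Multiset.exists_cons_of_mem hu
      rw [Multiset.erase_cons_head] at hcut'
      refine HasPacking.of_split (ih _ ?_ _ rfl (balanced_split hbal) hcut')
      rw [← hm]
      simp

end Splitting

end DiTree

namespace DiTree

/-! ### Out-trees, paths and cuts -/

section Trees

variable {V : Type*}

/-- If all vertices of `S` can be reached from `r` along `R`, some out-tree with arcs in `R`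
contains `S`. -/
theorem exists_outTree [Finite V] {D : Digraph V} {S : Finset V} {r : V} {R : V → V → Prop}
    (hR : ∀ u v, R u v → D.Adj u v) (hS : ∀ s ∈ S, Relation.ReflTransGen R r s) :
    ∃ T : OutTree D r, (S : Set V) ⊆ T.verts ∧ ∀ u v, (u, v) ∈ T.arcs → R u v := by
  classical
  let level : ℕ → Set V := fun k => {v | ∃ f : ℕ → V, f 0 = r ∧ f k = v ∧ ∀ i < k, R (f i) (f (i + 1))}
  have hlevel : ∀ v, Relation.ReflTransGen R r v → ∃ k, v ∈ level k := by
    intro v hv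
    induction hv with
    | refl => exact ⟨0, fun _ => r, rfl, rfl, by simp⟩
    | @tail b c _ hbc ih =>
      obtain ⟨k, f, h0, hk, hf⟩ := ih
      refine ⟨k + 1, fun i => if i ≤ k then f i else c, by simp [h0], by simp, ?_⟩
      intro i hi
      rcases Nat.lt_succ_iff_lt_or_eq.1 hi with h | rfl
      · simpa [h.le, Nat.succ_le_of_lt h] using hf i h
      · simpa [hk] using hbc
  have hprev : ∀ v k, v ∈ level (k + 1) → ∃ u ∈ level k, R u v := by
    rintro v k ⟨f, h0, hk, hf⟩
    exact ⟨f k, ⟨f, h0, rfl, fun i hi => hf i (by omega)⟩, hk ▸ hf k (by omega)⟩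
  let reach : Set V := {v | ∃ k, v ∈ level k}
  -- `d` is the distance from `r`; each vertex gets a parent that is strictly closer, so the tree is
  -- a breadth-first tree.
  let d : V → ℕ := fun v => if h : ∃ k, v ∈ level k then Nat.find h else 0
  have hd : ∀ v ∈ reach, v ∈ level (d v) := by
    intro v hv
    simp only [d, dif_pos (show ∃ k, v ∈ level k from hv)]
    exact Nat.find_spec (show ∃ k, v ∈ level k from hv)
  have hdmin : ∀ v k, v ∈ level k → d v ≤ k := by
    intro v k hk
    have hv : ∃ k, v ∈ level k := ⟨k, hk⟩
    simp only [d, dif_pos hv]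
    exact Nat.find_min' hv hk
  have hr : r ∈ reach := ⟨0, fun _ => r, rfl, rfl, by simp⟩
  have hpar : ∀ v, ∃ u, v ∈ reach → v ≠ r → u ∈ reach ∧ R u v ∧ d u < d v := by
    intro v
    by_cases hv : v ∈ reach ∧ v ≠ r
    · obtain ⟨hv, hvr⟩ := hv
      have h := hd v hv
      cases hk : d v with
      | zero =>
        rw [hk] at h
        obtain ⟨f, h0, h0', -⟩ := h
        exact absurd (h0'.symm.trans h0) hvr
      | succ k =>
        rw [hk] at h
        obtain ⟨u, hu, huv⟩ := hprev v k h
        exact ⟨u, fun _ _ => ⟨⟨k, hu⟩, huv, Nat.lt_succ_of_le (hdmin u k hu)⟩⟩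
    · exact ⟨r, fun h1 h2 => absurd ⟨h1, h2⟩ hv⟩
  choose p hp using hpar
  let arcs : Set (V × V) := {a | a.2 ∈ reach ∧ a.2 ≠ r ∧ a.1 = p a.2}
  have harc : ∀ u v, (u, v) ∈ arcs ↔ v ∈ reach ∧ v ≠ r ∧ u = p v := fun u v => Iff.rfl
  let G : SimpleGraph reach := (SimpleGraph.fromRel fun u v => (u, v) ∈ arcs).induce reach
  have hadj : ∀ v (hv : v ∈ reach) (hvr : v ≠ r), G.Adj ⟨p v, (hp v hv hvr).1⟩ ⟨v, hv⟩ := by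
    intro v hv hvr
    simp only [G, SimpleGraph.comap_adj, SimpleGraph.fromRel_adj, Function.Embedding.subtype_apply]
    refine ⟨fun h => ?_, .inl ((harc _ _).2 ⟨hv, hvr, rfl⟩)⟩
    have := (hp v hv hvr).2.2
    rw [h] at this
    exact lt_irrefl _ this
  have hconn : G.Connected := by
    rw [SimpleGraph.connected_iff_exists_forall_reachable]
    refine ⟨⟨r, hr⟩, ?_⟩
    suffices H : ∀ (k : ℕ) (v : V) (hv : v ∈ reach), d v = k → G.Reachable ⟨r, hr⟩ ⟨v, hv⟩ from
      fun w => H _ w.1 w.2 rfl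
    intro k
    induction k using Nat.strong_induction_on with
    | _ k ih =>
      intro v hv hk
      by_cases hvr : v = r
      · subst hvr
        exact SimpleGraph.Reachable.refl _
      · exact (ih _ (hk ▸ (hp v hv hvr).2.2) (p v) (hp v hv hvr).1 rfl).trans
          (hadj v hv hvr).reachable
  have htree : G.IsTree := by
    rw [SimpleGraph.isTree_iff_connected_and_card]
    -- A connected graph is a tree once it has at most one edge fewer than vertices: every edge
    -- joins a non-root vertex to its parent.
    refine ⟨hconn, le_antisymm ?_ hconn.card_vert_le_card_edgeSet_add_one⟩
    let e : {v : reach // v ≠ ⟨r, hr⟩} → G.edgeSet := fun v =>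
      ⟨s(⟨p v.1.1, (hp v.1.1 v.1.2 fun h => v.2 (Subtype.ext h)).1⟩, v.1),
        hadj v.1.1 v.1.2 fun h => v.2 (Subtype.ext h)⟩
    have he : Function.Surjective e := by
      rintro ⟨x, hx⟩
      induction x using Sym2.ind with
      | _ a b =>
        have hab : G.Adj a b := hx
        simp only [G, SimpleGraph.comap_adj, SimpleGraph.fromRel_adj,
          Function.Embedding.subtype_apply] at hab
        rcases hab.2 with h | h
        · obtain ⟨-, h2, h3⟩ := (harc _ _).1 h
          refine ⟨⟨b, fun h => h2 (congrArg Subtype.val h)⟩, Subtype.ext ?_⟩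
          exact congrArg (fun z : reach => s(z, b)) (Subtype.ext h3.symm)
        · obtain ⟨-, h2, h3⟩ := (harc _ _).1 h
          refine ⟨⟨a, fun h => h2 (congrArg Subtype.val h)⟩, Subtype.ext ?_⟩
          exact (congrArg (fun z : reach => s(z, a)) (Subtype.ext h3.symm)).trans Sym2.eq_swap
    have h1 := Nat.card_le_card_of_surjective e he
    have h2 : Nat.card {v : reach // v ≠ ⟨r, hr⟩} + 1 = Nat.card reach := by
      have := Fintype.ofFinite reach
      rw [Nat.card_eq_fintype_card, Nat.card_eq_fintype_card, Fintype.card_subtype_compl,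
        Fintype.card_subtype_eq]
      have : 0 < Fintype.card reach := Fintype.card_pos_iff.2 ⟨⟨r, hr⟩⟩
      omega
    omega
  refine ⟨{ verts := reach
            arcs := arcs
            adj_of_mem := fun u v h => ?_
            ends_mem := fun u v h => ?_
            oriented := fun u v h h' => ?_
            isTree := htree
            root_mem := hr
            root_indeg := fun u h => ((harc _ _).1 h).2.1 rfl
            indeg := fun v hv hvr => ⟨p v, (harc _ _).2 ⟨hv, hvr, rfl⟩, fun u h =>
              ((harc _ _).1 h).2.2⟩ }, fun s hs => hlevel s (hS s hs), fun u v h => ?_⟩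
  · obtain ⟨h1, h2, rfl⟩ := (harc _ _).1 h
    exact hR _ _ (hp v h1 h2).2.1
  · obtain ⟨h1, h2, rfl⟩ := (harc _ _).1 h
    exact ⟨(hp v h1 h2).1, h1⟩
  · obtain ⟨h1, h2, h3⟩ := (harc _ _).1 h
    obtain ⟨h4, h5, h6⟩ := (harc _ _).1 h'
    have h7 := (hp v h1 h2).2.2
    have h8 := (hp u h4 h5).2.2
    rw [← h3] at h7
    rw [← h6] at h8
    omega
  · obtain ⟨h1, h2, rfl⟩ := (harc _ _).1 h
    exact (hp v h1 h2).2.1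

/-- The undirected walk from the root can be followed while staying within the vertices reached by
directed walks. -/
theorem OutTree.reflTransGen {D : Digraph V} {r : V} (T : OutTree D r) {s : V}
    (hs : s ∈ T.verts) : Relation.ReflTransGen (fun a b => (a, b) ∈ T.arcs) r s := by
  suffices H : ∀ x y : T.verts, ((SimpleGraph.fromRel fun u v => (u, v) ∈ T.arcs).induce
      T.verts).Walk x y → Relation.ReflTransGen (fun a b => (a, b) ∈ T.arcs) r x.1 →
      Relation.ReflTransGen (fun a b => (a, b) ∈ T.arcs) r y.1 by
    obtain ⟨w⟩ := T.isTree.connected.preconnected ⟨r, T.root_mem⟩ ⟨s, hs⟩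
    exact H _ _ w .refl
  intro x y w
  induction w with
  | nil => exact id
  | @cons x z y h w ih =>
    intro hx
    refine ih ?_
    simp only [SimpleGraph.comap_adj, SimpleGraph.fromRel_adj,
      Function.Embedding.subtype_apply] at h
    rcases h.2 with h | h
    · exact hx.tail h
    -- The walk goes against an arc into `x`. That arc is the only one into `x`, so the directed
    -- walk to `x` ended with it and its tail has been reached.
    · rcases Relation.ReflTransGen.cases_tail hx with h' | ⟨b, hb, hbx⟩
      · rw [h'] at h
        exact absurd h (T.root_indeg _)
      · have hxr : x.1 ≠ r := fun e => T.root_indeg _ (e ▸ h)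
        rwa [(T.indeg x.1 x.2 hxr).unique h hbx]

theorem exists_list_of_reflTransGen {R : V → V → Prop} {x y : V}
    (h : Relation.ReflTransGen R x y) :
    ∃ p : List V, p.head? = some x ∧ p.getLast? = some y ∧ p.Nodup ∧ p.IsChain R := by
  induction h with
  | refl => exact ⟨[x], by simp⟩
  | @tail b c _ hbc ih =>
    obtain ⟨p, h1, h2, h3, h4⟩ := ih
    by_cases hc : c ∈ p
    · obtain ⟨l₁, l₂, rfl⟩ := List.append_of_mem hc
      -- If `c` has been visited, the path is cut off there.
      have e : l₁ ++ c :: l₂ = (l₁ ++ [c]) ++ l₂ := by simp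
      rw [e] at h1 h3 h4
      refine ⟨l₁ ++ [c], ?_, by simp, h3.of_append_left, h4.left_of_append⟩
      cases l₁ <;> simpa using h1
    · refine ⟨p ++ [c], ?_, by simp, ?_, ?_⟩
      · cases p with
        | nil => simp at h1
        | cons a p => simpa using h1
      · rw [List.nodup_append]
        refine ⟨h3, by simp, ?_⟩
        rintro a ha _ hb rfl
        exact hc (by simp at hb; exact hb ▸ ha)
      · rw [List.isChain_append]
        refine ⟨h4, by simp, ?_⟩
        intro a ha b' hb'
        rw [h2] at ha
        simp at ha hb'
        subst ha hb'
        exact hbc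

theorem rel_of_mem_pathArcs {R : V → V → Prop} {p : List V} (h : p.IsChain R) {a : V × V}
    (ha : a ∈ pathArcs p) : R a.1 a.2 := by
  induction p with
  | nil => simp [pathArcs] at ha
  | cons x p ih =>
    cases p with
    | nil => simp [pathArcs] at ha
    | cons y p =>
      rw [List.isChain_cons_cons] at h
      simp only [pathArcs, List.tail_cons, List.zip_cons_cons, List.mem_cons,
        Set.mem_ofPred_eq] at ha
      rcases ha with rfl | ha
      · exact h.1
      · exact ih h.2 ha

theorem exists_pathArc_entering {X : Set V} {x y : V} {p : List V} (h1 : p.head? = some x)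
    (h2 : p.getLast? = some y) (hx : x ∉ X) (hy : y ∈ X) :
    ∃ a ∈ pathArcs p, a.1 ∉ X ∧ a.2 ∈ X := by
  induction p generalizing x with
  | nil => simp at h1
  | cons z p ih =>
    simp at h1
    subst h1
    cases p with
    | nil =>
      simp at h2
      subst h2
      exact absurd hy hx
    | cons w p =>
      by_cases hw : w ∈ X
      · exact ⟨(z, w), by simp [pathArcs], hx, hw⟩
      · obtain ⟨a, ha, h⟩ := ih (x := w) (by simp) (by simpa using h2) hw
        refine ⟨a, ?_, h⟩
        simp only [pathArcs, List.tail_cons, List.zip_cons_cons, List.mem_cons,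
          Set.mem_ofPred_eq] at ha ⊢
        exact .inr ha

theorem natCast_le_iSup_iff {P : ℕ → Prop} (hP : ∀ m n, m ≤ n → P n → P m) (h0 : P 0) (ℓ : ℕ) :
    (ℓ : ℕ∞) ≤ (⨆ (k : ℕ) (_ : P k), (k : ℕ∞)) ↔ P ℓ := by
  refine ⟨fun h => ?_, fun h => le_iSup₂_of_le ℓ h le_rfl⟩
  by_contra hℓ
  cases ℓ with
  | zero => exact hℓ h0
  | succ m =>
    have : (⨆ (k : ℕ) (_ : P k), (k : ℕ∞)) ≤ (m : ℕ∞) := by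
      refine iSup₂_le fun k hk => ?_
      have : k ≤ m := by
        by_contra hlt
        exact hℓ (hP _ _ (by omega) hk)
      exact_mod_cast this
    have := h.trans this
    norm_cast at this
    omega

theorem le_treeConn_iff {D : Digraph V} {S : Finset V} {r : V} (ℓ : ℕ) :
    (ℓ : ℕ∞) ≤ treeConn D S r ↔ ∃ T : Fin ℓ → OutTree D r, (∀ i, (S : Set V) ⊆ (T i).verts) ∧
      ∀ i j, i ≠ j → Disjoint (T i).arcs (T j).arcs := by
  refine natCast_le_iSup_iff ?_ ⟨fun i => i.elim0, fun i => i.elim0, fun i => i.elim0⟩ ℓ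
  rintro m n hmn ⟨T, h1, h2⟩
  exact ⟨fun i => T (i.castLE hmn), fun i => h1 _, fun i j hij => h2 _ _ fun h =>
    hij (Fin.castLE_injective hmn h)⟩

theorem le_arcConn_iff {D : Digraph V} {x y : V} (ℓ : ℕ) :
    (ℓ : ℕ∞) ≤ arcConn D x y ↔ ∃ P : Fin ℓ → List V, (∀ i, IsPath D x y (P i)) ∧
      ∀ i j, i ≠ j → Disjoint (pathArcs (P i)) (pathArcs (P j)) := by
  refine natCast_le_iSup_iff ?_ ⟨fun i => i.elim0, fun i => i.elim0, fun i => i.elim0⟩ ℓ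
  rintro m n hmn ⟨T, h1, h2⟩
  exact ⟨fun i => T (i.castLE hmn), fun i => h1 _, fun i j hij => h2 _ _ fun h =>
    hij (Fin.castLE_injective hmn h)⟩

theorem le_arcConn_of_le_treeConn {D : Digraph V} {S : Finset V} {r s : V} {ℓ : ℕ} (hs : s ∈ S)
    (h : (ℓ : ℕ∞) ≤ treeConn D S r) : (ℓ : ℕ∞) ≤ arcConn D r s := by
  rw [le_treeConn_iff] at h
  rw [le_arcConn_iff]
  obtain ⟨T, hT, hdis⟩ := h
  choose P h1 h2 h3 h4 using fun i => exists_list_of_reflTransGen ((T i).reflTransGen (hT i hs))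
  refine ⟨P, fun i => ⟨h1 i, h2 i, h3 i, (h4 i).imp fun u v => (T i).adj_of_mem u v⟩, ?_⟩
  intro i j hij
  exact (hdis i j hij).mono (fun a ha => rel_of_mem_pathArcs (h4 i) ha)
    (fun a ha => rel_of_mem_pathArcs (h4 j) ha)

/-- The arcs of `D` that enter `X`. -/
def cutArcs (D : Digraph V) (X : Finset V) : Set (V × V) := {a | D.Adj a.1 a.2 ∧ a.1 ∉ X ∧ a.2 ∈ X}

/-- The easy half of Menger's theorem: each path has an arc in the cut, and disjoint paths have
different ones. -/
theorem le_ncard_cutArcs_of_le_arcConn [Finite V] {D : Digraph V} {r s : V} {ℓ : ℕ}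
    (h : (ℓ : ℕ∞) ≤ arcConn D r s) {X : Finset V} (hr : r ∉ X) (hs : s ∈ X) :
    ℓ ≤ (cutArcs D X).ncard := by
  rw [le_arcConn_iff] at h
  obtain ⟨P, hP, hdis⟩ := h
  have : ∀ i, ∃ a ∈ pathArcs (P i), a.1 ∉ (X : Set V) ∧ a.2 ∈ (X : Set V) := fun i =>
    exists_pathArc_entering (hP i).1 (hP i).2.1 (by simpa using hr) (by simpa using hs)
  choose a ha h1 h2 using this
  let e : Fin ℓ → cutArcs D X := fun i =>
    ⟨a i, rel_of_mem_pathArcs (hP i).2.2.2 (ha i), by simpa using h1 i, by simpa using h2 i⟩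
  have he : Function.Injective e := by
    intro i j hij
    by_contra hne
    have : a i = a j := congrArg Subtype.val hij
    exact Set.disjoint_left.1 (hdis i j hne) (ha i) (this ▸ ha j)
  simpa using Nat.card_le_card_of_injective e he

end Trees

/-! ### Arc sets of Eulerian digraphs and the equivalence of trees, paths and cuts -/

section Main

variable {V : Type*}

open Classical in
/-- The arcs of `D` as a multiset. -/
noncomputable def arcMultiset [Fintype V] (D : Digraph V) : Multiset (V × V) :=
  (Finset.univ.filter fun a : V × V => D.Adj a.1 a.2).val

theorem mem_arcMultiset [Fintype V] {D : Digraph V} {a : V × V} :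
    a ∈ arcMultiset D ↔ D.Adj a.1 a.2 := by simp [arcMultiset]

theorem nodup_arcMultiset [Fintype V] (D : Digraph V) : (arcMultiset D).Nodup :=
  Finset.nodup _

theorem entering_arcMultiset [Fintype V] [DecidableEq V] (D : Digraph V) (X : Finset V) :
    entering (arcMultiset D) X = (cutArcs D X).ncard := by
  classical
  rw [Set.ncard_eq_toFinset_card', entering, Multiset.countP_eq_card_filter, arcMultiset,
    ← Finset.filter_val, Finset.card_val, Finset.filter_filter]
  congr 1
  ext a
  rw [Set.mem_toFinset]
  simp [cutArcs]

theorem card_arcs_into [Fintype V] [DecidableEq V] (D : Digraph V) [DecidableRel D.Adj]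
    (X : Finset V) : (∑ v ∈ X, inDeg D v) =
      (Finset.univ.filter fun a : V × V => D.Adj a.1 a.2 ∧ a.2 ∈ X).card := by
  rw [Finset.card_eq_sum_card_fiberwise (f := Prod.snd) (t := X) (by intro a; simp)]
  refine Finset.sum_congr rfl fun v hv => ?_
  rw [inDeg, Set.ncard_eq_toFinset_card']
  refine Finset.card_nbij' (fun u => (u, v)) Prod.fst ?_ ?_ ?_ ?_
  · intro u; simp +contextual [hv]
  · rintro ⟨u, w⟩; simp +contextual
    rintro h - rfl; exact h
  · intro u; simp
  · rintro ⟨u, w⟩; simp +contextual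

theorem card_arcs_from [Fintype V] [DecidableEq V] (D : Digraph V) [DecidableRel D.Adj]
    (X : Finset V) : (∑ v ∈ X, outDeg D v) =
      (Finset.univ.filter fun a : V × V => D.Adj a.1 a.2 ∧ a.1 ∈ X).card := by
  rw [Finset.card_eq_sum_card_fiberwise (f := Prod.fst) (t := X) (by intro a; simp)]
  refine Finset.sum_congr rfl fun v hv => ?_
  rw [outDeg, Set.ncard_eq_toFinset_card']
  refine Finset.card_nbij' (fun u => (v, u)) Prod.snd ?_ ?_ ?_ ?_
  · intro u; simp +contextual [hv]
  · rintro ⟨u, w⟩; simp +contextual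
    rintro h - rfl; exact h
  · intro u; simp
  · rintro ⟨u, w⟩; simp +contextual

/-- Sum the degrees over `X` and cancel the arcs inside `X`. -/
theorem IsEulerian.entering_eq_leaving [Fintype V] [DecidableEq V] {D : Digraph V}
    (hD : IsEulerian D) (X : Finset V) :
    entering (arcMultiset D) X = leaving (arcMultiset D) X := by
  classical
  have h : (∑ v ∈ X, inDeg D v) = ∑ v ∈ X, outDeg D v :=
    Finset.sum_congr rfl fun v _ => (hD v).symm
  rw [card_arcs_into, card_arcs_from,
    ← Finset.card_filter_add_card_filter_not (fun a : V × V => a.1 ∈ X),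
    ← Finset.card_filter_add_card_filter_not (s := Finset.univ.filter fun a : V × V =>
      D.Adj a.1 a.2 ∧ a.1 ∈ X) (fun a : V × V => a.2 ∈ X)] at h
  simp only [Finset.filter_filter] at h
  rw [entering, leaving, Multiset.countP_eq_card_filter, Multiset.countP_eq_card_filter,
    arcMultiset, ← Finset.filter_val, ← Finset.filter_val, Finset.card_val, Finset.card_val,
    Finset.filter_filter, Finset.filter_filter]
  have e1 : (Finset.univ.filter fun a : V × V => (D.Adj a.1 a.2 ∧ a.2 ∈ X) ∧ a.1 ∈ X) =
      Finset.univ.filter fun a : V × V => (D.Adj a.1 a.2 ∧ a.1 ∈ X) ∧ a.2 ∈ X := by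
    ext; simp; tauto
  have e2 : (Finset.univ.filter fun a : V × V => (D.Adj a.1 a.2 ∧ a.2 ∈ X) ∧ a.1 ∉ X) =
      Finset.univ.filter fun a : V × V => D.Adj a.1 a.2 ∧ a.1 ∉ X ∧ a.2 ∈ X := by
    ext; simp; tauto
  have e3 : (Finset.univ.filter fun a : V × V => (D.Adj a.1 a.2 ∧ a.1 ∈ X) ∧ a.2 ∉ X) =
      Finset.univ.filter fun a : V × V => D.Adj a.1 a.2 ∧ a.1 ∈ X ∧ a.2 ∉ X := by
    ext; simp; tauto
  rw [e1, e2, e3] at h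
  convert Nat.add_left_cancel h using 2

theorem le_treeConn_of_cuts [Finite V] {D : Digraph V} (hD : IsEulerian D) {S : Finset V} {r : V}
    (hr : r ∈ S) {ℓ : ℕ}
    (h : ∀ X : Finset V, r ∉ X → (∃ s ∈ S, s ∈ X) → ℓ ≤ (cutArcs D X).ncard) :
    (ℓ : ℕ∞) ≤ treeConn D S r := by
  classical
  have := Fintype.ofFinite V
  rw [le_treeConn_iff]
  obtain ⟨f, hf, hreach⟩ := hasPacking_of_balanced (ℓ := ℓ) hr (arcMultiset D)
    hD.entering_eq_leaving (fun X hX ⟨s, hs⟩ => by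
      rw [entering_arcMultiset]
      rw [Finset.mem_inter] at hs
      exact h X hX ⟨s, hs.2, hs.1⟩)
  have hle : ∀ i, f i ≤ arcMultiset D := fun i =>
    (Finset.single_le_sum (f := f) (fun _ _ => zero_le) (Finset.mem_univ i)).trans hf
  have hT : ∀ i, ∃ T : OutTree D r, (S : Set V) ⊆ T.verts ∧
      ∀ u v, (u, v) ∈ T.arcs → (u, v) ∈ f i := fun i =>
    exists_outTree (fun u v huv => mem_arcMultiset.1 (Multiset.mem_of_le (hle i) huv)) (hreach i)
  choose T h1 h2 using hT
  refine ⟨T, h1, fun i j hij => Set.disjoint_left.2 ?_⟩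
  rintro ⟨u, v⟩ hi hj
  have hi := h2 i u v hi
  have hj := h2 j u v hj
  -- `D` has no parallel arcs, so parts whose sum lies below its arc multiset share no arc.
  have hle2 : f i + f j ≤ arcMultiset D := by
    refine le_trans ?_ hf
    rw [← Finset.sum_pair hij]
    exact Finset.sum_le_sum_of_subset (Finset.subset_univ _)
  have hnd := Multiset.nodup_of_le hle2 (nodup_arcMultiset D)
  exact Multiset.disjoint_left.1 (Multiset.nodup_add.1 hnd).2.2 hi hj

theorem le_treeConn_iff_cuts [Finite V] {D : Digraph V} (hD : IsEulerian D) {S : Finset V} {r : V}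
    (hr : r ∈ S) (ℓ : ℕ) : (ℓ : ℕ∞) ≤ treeConn D S r ↔
      ∀ X : Finset V, r ∉ X → (∃ s ∈ S, s ∈ X) → ℓ ≤ (cutArcs D X).ncard :=
  ⟨fun h _ hX ⟨_, hs, hsX⟩ =>
    le_ncard_cutArcs_of_le_arcConn (le_arcConn_of_le_treeConn hs h) hX hsX,
    le_treeConn_of_cuts hD hr⟩

theorem le_treeConn_iff_arcConn [Finite V] {D : Digraph V} (hD : IsEulerian D) {S : Finset V}
    {r : V} (hr : r ∈ S) (ℓ : ℕ) : (ℓ : ℕ∞) ≤ treeConn D S r ↔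
      ∀ s ∈ S, s ≠ r → (ℓ : ℕ∞) ≤ arcConn D r s := by
  refine ⟨fun h s hs _ => le_arcConn_of_le_treeConn hs h, fun h => le_treeConn_of_cuts hD hr ?_⟩
  rintro X hX ⟨s, hs, hsX⟩
  exact le_ncard_cutArcs_of_le_arcConn (h s hs fun e => hX (e ▸ hsX)) hX hsX

theorem IsSymmetric.isEulerian {D : Digraph V} (hD : IsSymmetric D) : IsEulerian D := by
  intro v
  unfold outDeg inDeg
  congr 1
  ext w
  exact ⟨hD v w, hD w v⟩

end Main

end DiTree

/-! ## Bounded-loop programs -/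

namespace RAM

/-- Assign the value `c` to the cell `i` of the array `a`. -/
def Store.setArr (σ : Store) (a i c : ℕ) : Store :=
  { σ with arr := Function.update σ.arr a (Function.update (σ.arr a) i c) }

section Store

variable (σ : Store) (x y a b i c : ℕ)

@[simp] theorem Store.reg_setReg : (σ.setReg x c).reg y = if y = x then c else σ.reg y := by
  simp [Store.setReg, Function.update_apply]

@[simp] theorem Store.arr_setReg : (σ.setReg x c).arr = σ.arr := rfl

@[simp] theorem Store.reg_setArr : (σ.setArr a i c).reg = σ.reg := rfl

@[simp] theorem Store.arr_setArr :
    (σ.setArr a i c).arr b = if b = a then Function.update (σ.arr a) i c else σ.arr b := by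
  simp only [Store.setArr, Function.update_apply]

end Store

/-- Programs whose loops are all executed as many times as register `0` says. -/
inductive Code where
  /-- a single instruction -/
  | instr (i : Instr)
  /-- first `P`, then `Q` -/
  | seq (P Q : Code)
  /-- if register `x` is nonzero then `P` else `Q` -/
  | branch (x : ℕ) (P Q : Code)
  /-- for `x` from the value of register `0`, exclusive, down to `0` do `P` -/
  | rep (x : ℕ) (P : Code)

namespace Code

/-- Sequential composition. -/
scoped infixr:60 " ;; " => Code.seq

/-- The translation to programs; register `1` is set to `1` in each round of a loop. -/
def compile : Code → Prog
  | .instr i => .instr i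
  | .seq P Q => .seq P.compile Q.compile
  | .branch x P Q => .cond x P.compile Q.compile
  | .rep x P => .seq (.instr (.copy x 0)) (.loop x (.seq (.instr (.const 1 1))
      (.seq (.instr (.sub x x 1)) P.compile)))

/-- Apply `f` with register `x` set to `k - 1`, …, `1`, `0` in turn. -/
def countdown (x : ℕ) (f : Store → Store) : ℕ → Store → Store
  | 0, σ => σ
  | k + 1, σ => countdown x f k (f ((σ.setReg 1 1).setReg x k))

/-- The memory after the execution. -/
def eval : Code → Store → Store
  | .instr i, σ => i.exec σ
  | .seq P Q, σ => Q.eval (P.eval σ)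
  | .branch x P Q, σ => if σ.reg x ≠ 0 then P.eval σ else Q.eval σ
  | .rep x P, σ => countdown x P.eval (σ.reg 0) (σ.setReg x (σ.reg 0))

/-- No instruction writes register `y`. -/
def keepsReg (y : ℕ) : Code → Bool
  | .instr (.const x _) => x != y
  | .instr (.copy x _) => x != y
  | .instr (.add x _ _) => x != y
  | .instr (.sub x _ _) => x != y
  | .instr (.load x _ _) => x != y
  | .instr (.store _ _ _) => true
  | .seq P Q => P.keepsReg y && Q.keepsReg y
  | .branch _ P Q => P.keepsReg y && Q.keepsReg y
  -- Register `1` counts as written by every loop; `keepsOne` is the substitute.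
  | .rep x P => x != y && y != 1 && P.keepsReg y

/-- No instruction writes register `1`. -/
def keepsOne : Code → Bool
  | .instr i => (Code.instr i).keepsReg 1
  | .seq P Q => P.keepsOne && Q.keepsOne
  | .branch _ P Q => P.keepsOne && Q.keepsOne
  | .rep x P => x != 1 && P.keepsOne

/-- No instruction writes the array `a`. -/
def keepsArr (a : ℕ) : Code → Bool
  | .instr (.store b _ _) => b != a
  | .instr _ => true
  | .seq P Q => P.keepsArr a && Q.keepsArr a
  | .branch _ P Q => P.keepsArr a && Q.keepsArr a
  | .rep _ P => P.keepsArr a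

/-- The loop counters and register `0` are not written in the loops. -/
def wellFormed : Code → Bool
  | .instr _ => true
  | .seq P Q => P.wellFormed && Q.wellFormed
  | .branch _ P Q => P.wellFormed && Q.wellFormed
  | .rep x P => x != 1 && P.keepsReg x && P.keepsReg 0 && P.wellFormed && x != 0

/-- A bound on the running time in terms of the value of register `0`. -/
noncomputable def time : Code → Polynomial ℕ
  | .instr _ => 1
  | .seq P Q => P.time + Q.time
  | .branch _ P Q => P.time + Q.time + 1
  -- Besides its body a round costs three steps: two instructions and the loop test. Copying the
  -- counter and the last test add two.
  | .rep _ P => Polynomial.X * (P.time + 3) + 2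

/-! ### Frame properties, running time and loop invariants of codes -/

theorem countdown_reg {x y : ℕ} {f : Store → Store} (hxy : x ≠ y) (hy : y ≠ 1)
    (hf : ∀ σ, (f σ).reg y = σ.reg y) (k : ℕ) (σ : Store) :
    (countdown x f k σ).reg y = σ.reg y := by
  induction k generalizing σ with
  | zero => rfl
  | succ k ih => simp [countdown, ih, hf, hxy.symm, hy]

theorem countdown_arr {x a : ℕ} {f : Store → Store} (hf : ∀ σ, (f σ).arr a = σ.arr a) (k : ℕ)
    (σ : Store) : (countdown x f k σ).arr a = σ.arr a := by
  induction k generalizing σ with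
  | zero => rfl
  | succ k ih => simp [countdown, ih, hf]

theorem eval_reg {y : ℕ} (P : Code) (h : P.keepsReg y = true) (σ : Store) :
    (P.eval σ).reg y = σ.reg y := by
  induction P generalizing σ with
  | instr i =>
    have H : ∀ x c : ℕ, x ≠ y → (σ.setReg x c).reg y = σ.reg y := fun x c hx => by
      simp [hx.symm]
    cases i <;> simp only [keepsReg, bne_iff_ne] at h <;> first | exact H _ _ h | rfl
  | seq P Q hP hQ => simp_all [eval, keepsReg]
  | branch x P Q hP hQ =>
    simp only [keepsReg, Bool.and_eq_true] at h
    simp only [eval]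
    split_ifs <;> simp_all
  | rep x P hP =>
    simp only [keepsReg, Bool.and_eq_true, bne_iff_ne] at h
    simp only [eval]
    rw [countdown_reg h.1.1 h.1.2 (hP h.2)]
    simp [h.1.1.symm]

theorem eval_reg_one (P : Code) (h : P.keepsOne = true) {σ : Store} (hσ : σ.reg 1 = 1) :
    (P.eval σ).reg 1 = 1 := by
  induction P generalizing σ with
  | instr i => exact (eval_reg _ h σ).trans hσ
  | seq P Q hP hQ =>
    simp only [keepsOne, Bool.and_eq_true] at h
    exact hQ h.2 (hP h.1 hσ)
  | branch x P Q hP hQ =>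
    simp only [keepsOne, Bool.and_eq_true] at h
    simp only [eval]
    split_ifs <;> simp_all
  | rep x P hP =>
    simp only [keepsOne, Bool.and_eq_true, bne_iff_ne] at h
    have key : ∀ (k : ℕ) (τ : Store), τ.reg 1 = 1 → (countdown x P.eval k τ).reg 1 = 1 := by
      intro k
      induction k with
      | zero => exact fun _ h => h
      | succ k ih => exact fun τ _ => ih _ (hP h.2 (by simp [h.1.symm]))
    exact key _ _ (by simp [h.1.symm, hσ])

theorem eval_arr {a : ℕ} (P : Code) (h : P.keepsArr a = true) (σ : Store) :
    (P.eval σ).arr a = σ.arr a := by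
  induction P generalizing σ with
  | instr i =>
    cases i <;> first
      | rfl
      | simp only [keepsArr, bne_iff_ne] at h
        simp [eval, Instr.exec, Function.update_of_ne h.symm]
  | seq P Q hP hQ => simp_all [eval, keepsArr]
  | branch x P Q hP hQ =>
    simp only [keepsArr, Bool.and_eq_true] at h
    simp only [eval]
    split_ifs <;> simp_all
  | rep x P hP =>
    simp only [eval]
    rw [countdown_arr (hP h)]
    simp

/-- The body of a loop changes neither its counter nor register `0`, so the number of rounds is
register `0`, and the bound for every round may be evaluated at the initial value. -/
theorem runs_compile (P : Code) (h : P.wellFormed = true) (h0 : P.keepsReg 0 = true) (σ : Store) :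
    ∃ t, Runs P.compile σ (P.eval σ) t ∧ t ≤ P.time.eval (σ.reg 0) := by
  induction P generalizing σ with
  | instr i => exact ⟨1, .instr i σ, by simp [time]⟩
  | seq P Q hP hQ =>
    simp only [wellFormed, keepsReg, Bool.and_eq_true] at h h0
    obtain ⟨s, hs, hs'⟩ := hP h.1 h0.1 σ
    obtain ⟨t, ht, ht'⟩ := hQ h.2 h0.2 (P.eval σ)
    rw [P.eval_reg h0.1] at ht'
    refine ⟨s + t, .seq hs ht, ?_⟩
    simp only [time, Polynomial.eval_add]
    omega
  | branch x P Q hP hQ =>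
    simp only [wellFormed, keepsReg, Bool.and_eq_true] at h h0
    simp only [time, Polynomial.eval_add, Polynomial.eval_one, eval]
    by_cases hx : σ.reg x = 0
    · obtain ⟨t, ht, ht'⟩ := hQ h.2 h0.2 σ
      refine ⟨t + 1, .cond_false hx (by simpa [hx] using ht), by omega⟩
    · obtain ⟨t, ht, ht'⟩ := hP h.1 h0.1 σ
      refine ⟨t + 1, .cond_true hx (by simpa [hx] using ht), by omega⟩
  | rep x P hP =>
    simp only [wellFormed, keepsReg, Bool.and_eq_true, bne_iff_ne] at h h0
    obtain ⟨⟨⟨⟨hx1, hPx⟩, hP0⟩, hPw⟩, hx0⟩ := h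
    have key : ∀ (k : ℕ) (τ : Store), τ.reg x = k → τ.reg 0 = σ.reg 0 →
        ∃ t, Runs (.loop x (.seq (.instr (.const 1 1)) (.seq (.instr (.sub x x 1)) P.compile)))
          τ (countdown x P.eval k τ) t ∧ t ≤ k * (P.time.eval (σ.reg 0) + 3) + 1 := by
      intro k
      induction k with
      | zero => exact fun τ hτ _ => ⟨1, .loop_done hτ, by simp⟩
      | succ k ih =>
        intro τ hτ hτ0
        have e : Instr.exec (.sub x x 1) (Instr.exec (.const 1 1) τ) =
            (τ.setReg 1 1).setReg x k := by
          simp [Instr.exec, hx1, hτ]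
        obtain ⟨s, hs, hs'⟩ := hP hPw hP0 ((τ.setReg 1 1).setReg x k)
        obtain ⟨t, ht, ht'⟩ := ih (P.eval ((τ.setReg 1 1).setReg x k))
          (by simp [P.eval_reg hPx]) (by simp [P.eval_reg hP0, hx0.symm, hτ0])
        refine ⟨(1 + (1 + s)) + t + 1, .loop_step (by omega)
          (.seq (.instr _ _) (.seq (.instr _ _) (by rw [e]; exact hs))) ht, ?_⟩
        simp [hx0.symm, hτ0] at hs'
        rw [Nat.succ_mul]
        omega
    obtain ⟨t, ht, ht'⟩ := key (σ.reg 0) (σ.setReg x (σ.reg 0)) (by simp) (by simp)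
    refine ⟨1 + t, .seq (.instr _ _) ht, ?_⟩
    simp only [time, Polynomial.eval_add, Polynomial.eval_mul, Polynomial.eval_X,
      Polynomial.eval_ofNat]
    omega

/-- `J k` is the invariant with `k` rounds left. The step may also use that whatever the loop does
not write is as it was before the loop. -/
theorem rep_induction {x : ℕ} {P : Code} (J : ℕ → Store → Prop) (σ : Store)
    (h0 : J (σ.reg 0) (σ.setReg x (σ.reg 0)))
    (hstep : ∀ k < σ.reg 0, ∀ τ : Store,
      (∀ y, (rep x P).keepsReg y = true → τ.reg y = σ.reg y) →
      (∀ a, P.keepsArr a = true → τ.arr a = σ.arr a) →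
      J (k + 1) τ → J k (P.eval ((τ.setReg 1 1).setReg x k))) :
    J 0 ((rep x P).eval σ) := by
  suffices H : ∀ k ≤ σ.reg 0, ∀ τ : Store,
      (∀ y, (rep x P).keepsReg y = true → τ.reg y = σ.reg y) →
      (∀ a, P.keepsArr a = true → τ.arr a = σ.arr a) →
      J k τ → J 0 (countdown x P.eval k τ) by
    refine H _ le_rfl _ (fun y hy => ?_) (fun a _ => by simp) h0
    simp only [keepsReg, Bool.and_eq_true, bne_iff_ne] at hy
    simp [hy.1.1.symm]
  intro k
  induction k with
  | zero => exact fun _ _ _ _ h => h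
  | succ k ih =>
    intro hk τ hreg harr hJ
    refine ih (by omega) _ (fun y hy => ?_) (fun a ha => ?_) (hstep k (by omega) τ hreg harr hJ)
    · have hy' := hy
      simp only [keepsReg, Bool.and_eq_true, bne_iff_ne] at hy'
      rw [P.eval_reg hy'.2]
      simp [hy'.1.1.symm, hy'.1.2, hreg y hy]
    · rw [P.eval_arr ha]
      simp [harr a ha]

@[simp] theorem eval_seq (P Q : Code) (σ : Store) : (P ;; Q).eval σ = Q.eval (P.eval σ) := rfl

@[simp] theorem eval_branch (x : ℕ) (P Q : Code) (σ : Store) :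
    (branch x P Q).eval σ = if σ.reg x ≠ 0 then P.eval σ else Q.eval σ := rfl

section Instructions

/-- `x := c` -/
abbrev const (x c : ℕ) : Code := .instr (.const x c)
/-- `x := y` -/
abbrev copy (x y : ℕ) : Code := .instr (.copy x y)
/-- `x := y + z` -/
abbrev add (x y z : ℕ) : Code := .instr (.add x y z)
/-- `x := y - z` -/
abbrev sub (x y z : ℕ) : Code := .instr (.sub x y z)
/-- `x := a[y]` -/
abbrev load (x a y : ℕ) : Code := .instr (.load x a y)
/-- `a[x] := y` -/
abbrev store (a x y : ℕ) : Code := .instr (.store a x y)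
/-- do nothing -/
abbrev skip : Code := .instr (.copy 19 19)

variable (x y z a c : ℕ) (σ : Store)

@[simp] theorem eval_const : (const x c).eval σ = σ.setReg x c := rfl
@[simp] theorem eval_copy : (copy x y).eval σ = σ.setReg x (σ.reg y) := rfl
theorem eval_skip : skip.eval σ = σ := by
  simp [eval, Instr.exec, Store.setReg]
@[simp] theorem eval_add : (add x y z).eval σ = σ.setReg x (σ.reg y + σ.reg z) := rfl
@[simp] theorem eval_sub : (sub x y z).eval σ = σ.setReg x (σ.reg y - σ.reg z) := rfl
@[simp] theorem eval_load : (load x a y).eval σ = σ.setReg x (σ.arr a (σ.reg y)) := rfl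
@[simp] theorem eval_store : (store a x y).eval σ = σ.setArr a (σ.reg x) (σ.reg y) := rfl

end Instructions

end Code

end RAM

/-! ## Minimum cuts by augmenting paths -/

namespace RAM

open Code

/-- A digraph with vertices `0, …, n - 1`, a root `r`, and arcs among the numbers less than `L`.
`good p` says that `p` is the index of an arc; its tail is `U p`, its head `W p`, and its
reverse `R p`. -/
structure Net where
  /-- a bound on the indices of the arcs -/
  L : ℕ
  /-- the number of vertices -/
  n : ℕ
  /-- the root -/
  r : ℕ
  /-- the tails -/
  U : ℕ → ℕ
  /-- the heads -/
  W : ℕ → ℕ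
  /-- the reverse arcs -/
  R : ℕ → ℕ
  /-- the indices of the arcs -/
  good : ℕ → Prop
  r_lt : r < n
  n_le : n ≤ L
  good_lt : ∀ p, good p → p < L
  -- This frees the index `0` to mean "no parent".
  good_ne : ∀ p, good p → p ≠ 0
  U_lt : ∀ p, good p → U p < n
  W_lt : ∀ p, good p → W p < n
  good_R : ∀ p, good p → good (R p)
  U_R : ∀ p, good p → U (R p) = W p
  W_R : ∀ p, good p → W (R p) = U p

namespace Net

variable (N : Net)

/-- The capacity of the cut of arcs leaving `X`. -/
def cut (C : ℕ → ℕ) (X : Finset ℕ) : ℕ :=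
  ∑ p ∈ Finset.range N.L, if N.U p ∈ X ∧ N.W p ∉ X then C p else 0

/-- The number of marked vertices. -/
def count (mark : ℕ → ℕ) : ℕ := ((Finset.range N.n).filter fun v => mark v ≠ 0).card

/-- No arc leaves the set of marked vertices. -/
def Closed (C mark : ℕ → ℕ) : Prop := ∀ p, C p ≠ 0 → mark (N.U p) ≠ 0 → mark (N.W p) ≠ 0

/-- `par` is the parent function of a tree of arcs of positive capacity on the marked vertices;
`mark` increases along the arcs. -/
structure IsSearch (C mark par : ℕ → ℕ) : Prop where
  par_root : par N.r = 0
  mark_root : mark N.r = 1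
  par_spec : ∀ v < N.n, mark v ≠ 0 → v ≠ N.r → N.good (par v) ∧ C (par v) ≠ 0 ∧
    N.W (par v) = v ∧ mark (N.U (par v)) ≠ 0 ∧ mark (N.U (par v)) < mark v
  -- Bounds the depth of the tree, so that `L` steps back suffice to reach the root.
  mark_le : ∀ v < N.n, mark v ≤ N.count mark

variable {N}

theorem cut_update {C : ℕ → ℕ} {p c : ℕ} (hp : p < N.L) (X : Finset ℕ) :
    N.cut (Function.update C p c) X + (if N.U p ∈ X ∧ N.W p ∉ X then C p else 0) =
      N.cut C X + (if N.U p ∈ X ∧ N.W p ∉ X then c else 0) := by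
  have hp' := Finset.mem_range.2 hp
  unfold cut
  rw [← Finset.add_sum_erase _ _ hp', ← Finset.add_sum_erase (Finset.range N.L)
    (fun p => if N.U p ∈ X ∧ N.W p ∉ X then C p else 0) hp']
  have : ∑ q ∈ (Finset.range N.L).erase p,
      (if N.U q ∈ X ∧ N.W q ∉ X then Function.update C p c q else 0) =
      ∑ q ∈ (Finset.range N.L).erase p, if N.U q ∈ X ∧ N.W q ∉ X then C q else 0 :=
    Finset.sum_congr rfl fun q hq => by rw [Function.update_of_ne (Finset.ne_of_mem_erase hq)]
  rw [this, Function.update_self]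
  omega

theorem count_le (mark : ℕ → ℕ) : N.count mark ≤ N.n :=
  (Finset.card_filter_le _ _).trans (Finset.card_range N.n).le

theorem one_le_count {mark : ℕ → ℕ} (h : mark N.r ≠ 0) : 1 ≤ N.count mark :=
  Finset.card_pos.2 ⟨N.r, by simp [N.r_lt, h]⟩

theorem IsSearch.step {C mark par : ℕ → ℕ} (h : N.IsSearch C mark par) {p : ℕ} (hg : N.good p)
    (hC : C p ≠ 0) (hU : mark (N.U p) ≠ 0) (hW : mark (N.W p) = 0) :
    N.IsSearch C (Function.update mark (N.W p) (mark (N.U p) + 1))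
      (Function.update par (N.W p) p) := by
  have hWr : N.r ≠ N.W p := fun e => by
    have := h.mark_root
    rw [e, hW] at this
    omega
  have hUW : ∀ u, mark u ≠ 0 → u ≠ N.W p := fun u hu e => hu (e ▸ hW)
  have hcount : N.count (Function.update mark (N.W p) (mark (N.U p) + 1)) = N.count mark + 1 := by
    unfold count
    rw [← Finset.card_insert_of_notMem (a := N.W p) (by simp [hW])]
    congr 1
    ext v
    by_cases hv : v = N.W p
    · simp [hv, N.W_lt p hg]
    · simp [hv]
  refine ⟨?_, ?_, ?_, ?_⟩
  · rw [Function.update_of_ne hWr, h.par_root]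
  · rw [Function.update_of_ne hWr, h.mark_root]
  · intro v hv hm hvr
    by_cases hvW : v = N.W p
    · subst hvW
      simp [hg, hC, Function.update_of_ne (hUW _ hU), hU]
    · rw [Function.update_of_ne hvW] at hm ⊢
      rw [Function.update_of_ne hvW]
      obtain ⟨h1, h2, h3, h4, h5⟩ := h.par_spec v hv hm hvr
      rw [Function.update_of_ne (hUW _ h4)]
      exact ⟨h1, h2, h3, h4, h5⟩
  · intro v hv
    rw [hcount]
    by_cases hvW : v = N.W p
    · subst hvW
      simpa using h.mark_le _ (N.U_lt p hg)
    · rw [Function.update_of_ne hvW]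
      exact (h.mark_le v hv).trans (Nat.le_succ _)

variable (N) in
/-- The memory holds the network: `L` and `r` in registers `0` and `4`, and `U`, `W` and `R` in the
arrays `2`, `3` and `4`. -/
structure Holds (σ : Store) : Prop where
  reg_L : σ.reg 0 = N.L
  reg_r : σ.reg 4 = N.r
  arr_U : σ.arr 2 = N.U
  arr_W : σ.arr 3 = N.W
  arr_R : σ.arr 4 = N.R

/-- `P` does not write the registers and arrays that hold the network. -/
def keepsNet (P : Code) : Bool :=
  P.keepsReg 0 && P.keepsReg 4 && P.keepsArr 2 && P.keepsArr 3 && P.keepsArr 4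

theorem Holds.congr {σ τ : Store} (h : N.Holds σ) (h0 : τ.reg 0 = σ.reg 0)
    (h4 : τ.reg 4 = σ.reg 4) (h2 : τ.arr 2 = σ.arr 2) (h3 : τ.arr 3 = σ.arr 3)
    (h4' : τ.arr 4 = σ.arr 4) : N.Holds τ :=
  ⟨h0.trans h.reg_L, h4.trans h.reg_r, h2.trans h.arr_U, h3.trans h.arr_W, h4'.trans h.arr_R⟩

theorem Holds.eval {σ : Store} (h : N.Holds σ) {P : Code} (hP : keepsNet P = true) :
    N.Holds (P.eval σ) := by
  simp only [keepsNet, Bool.and_eq_true] at hP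
  exact h.congr (P.eval_reg hP.1.1.1.1 σ) (P.eval_reg hP.1.1.1.2 σ) (P.eval_arr hP.1.1.2 σ)
    (P.eval_arr hP.1.2 σ) (P.eval_arr hP.2 σ)

theorem Holds.of_rep {σ τ : Store} (h : N.Holds σ) {x : ℕ} {P : Code}
    (hP : keepsNet (Code.rep x P) = true)
    (hreg : ∀ y, (Code.rep x P).keepsReg y = true → τ.reg y = σ.reg y)
    (harr : ∀ a, P.keepsArr a = true → τ.arr a = σ.arr a) : N.Holds τ := by
  simp only [keepsNet, Bool.and_eq_true] at hP
  exact h.congr (hreg 0 hP.1.1.1.1) (hreg 4 hP.1.1.1.2) (harr 2 hP.1.1.2)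
    (harr 3 hP.1.2) (harr 4 hP.2)

theorem Holds.setReg {σ : Store} (h : N.Holds σ) {x c : ℕ} (h0 : x ≠ 0) (h4 : x ≠ 4) :
    N.Holds (σ.setReg x c) :=
  h.congr (by simp [h0.symm]) (by simp [h4.symm]) rfl rfl rfl

end Net

/-- Mark the head of the arc in register `23` if its tail is marked and its capacity positive. -/
def relax : Code :=
  load 10 7 23 ;; branch 10
    (load 11 2 23 ;; load 10 8 11 ;; branch 10
      (load 11 3 23 ;; load 12 8 11 ;; branch 12 skip
        (add 10 10 1 ;; store 8 11 10 ;; store 9 11 23))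
      skip)
    skip

/-- One round of the search. -/
def pass : Code := rep 23 relax

/-- Remove all marks. -/
def clearMarks : Code := const 10 0 ;; rep 22 (store 8 22 10)

/-- Search the vertices that can be reached from the root. -/
def search : Code := clearMarks ;; store 8 4 1 ;; rep 22 pass

namespace Net

variable {N : Net}

theorem eval_relax {σ : Store} (h : N.Holds σ) (h1 : σ.reg 1 = 1) :
    let p := σ.reg 23
    let mark := σ.arr 8
    ((relax.eval σ).arr 8, (relax.eval σ).arr 9) =
      if σ.arr 7 p ≠ 0 ∧ mark (N.U p) ≠ 0 ∧ mark (N.W p) = 0 then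
        (Function.update mark (N.W p) (mark (N.U p) + 1), Function.update (σ.arr 9) (N.W p) p)
      else (mark, σ.arr 9) := by
  intro p mark
  by_cases hC : σ.arr 7 p = 0
  · simp [relax, hC, p, mark]
  by_cases hU : mark (N.U p) = 0
  · simp [relax, hC, h.arr_U, hU, p, mark] at *
  by_cases hW : mark (N.W p) = 0
  · simp [relax, h.arr_U, h.arr_W, h1, p, mark] at *
    simp [hC, hU, hW]
  · simp [relax, h.arr_U, h.arr_W, h1, p, mark] at *
    simp [hC, hU, hW]

/-- A pass that marks nothing new has tested every arc against the final marks. A pass over a closed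
set marks nothing, so closedness persists in later passes. -/
theorem eval_pass {C : ℕ → ℕ} (hgood : ∀ p, C p ≠ 0 → N.good p) {σ : Store} (h : N.Holds σ)
    (hC : σ.arr 7 = C) (hs : N.IsSearch C (σ.arr 8) (σ.arr 9)) :
    N.IsSearch C ((pass.eval σ).arr 8) ((pass.eval σ).arr 9) ∧
      (N.Closed C ((pass.eval σ).arr 8) ∨
        ¬ N.Closed C (σ.arr 8) ∧ N.count (σ.arr 8) < N.count ((pass.eval σ).arr 8)) := by
  have key := rep_induction (x := 23) (P := relax) (fun k τ =>
      N.IsSearch C (τ.arr 8) (τ.arr 9) ∧ (∀ v, σ.arr 8 v ≠ 0 → τ.arr 8 v ≠ 0) ∧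
      (N.Closed C (σ.arr 8) → ∀ v, τ.arr 8 v ≠ 0 → σ.arr 8 v ≠ 0) ∧
      (∀ p, k ≤ p → C p ≠ 0 → σ.arr 8 (N.U p) ≠ 0 → τ.arr 8 (N.W p) ≠ 0)) σ ?_ ?_
  · obtain ⟨h1, h2, h3, h4⟩ := key
    refine ⟨h1, ?_⟩
    by_cases hnew : ∀ v < N.n, (pass.eval σ).arr 8 v ≠ 0 → σ.arr 8 v ≠ 0
    · left
      intro p hp hU
      exact h4 p (Nat.zero_le _) hp (hnew _ (N.U_lt p (hgood p hp)) hU)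
    · right
      push Not at hnew
      obtain ⟨v, hv, hv1, hv2⟩ := hnew
      refine ⟨fun hcl => h3 hcl v hv1 hv2, Finset.card_lt_card ⟨?_, ?_⟩⟩
      · intro w hw
        rw [Finset.mem_filter] at hw ⊢
        exact ⟨hw.1, h2 w hw.2⟩
      · intro hsub
        have := hsub (Finset.mem_filter.2 ⟨Finset.mem_range.2 hv, hv1⟩)
        exact (Finset.mem_filter.1 this).2 hv2
  · refine ⟨hs, fun v hv => hv, fun _ v hv => hv, fun p hp hCp => ?_⟩
    have := N.good_lt p (hgood p hCp)
    rw [h.reg_L] at hp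
    omega
  · intro k hk τ hreg harr ⟨h1, h2, h3, h4⟩
    have hH : N.Holds τ := h.of_rep (by decide) hreg harr
    have e := eval_relax (σ := (τ.setReg 1 1).setReg 23 k)
      ((hH.setReg (by decide) (by decide)).setReg (by decide) (by decide)) (by simp)
    have h7 : τ.arr 7 = C := (harr 7 (by decide)).trans hC
    simp only [Store.reg_setReg, Store.arr_setReg, if_true, h7] at e
    split_ifs at e with hc
    · obtain ⟨hc1, hc2, hc3⟩ := hc
      obtain ⟨e1, e2⟩ := Prod.mk.inj e
      rw [e1, e2]
      have hne : ∀ v, τ.arr 8 v ≠ 0 → Function.update (τ.arr 8) (N.W k) (τ.arr 8 (N.U k) + 1) v ≠ 0 := by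
        intro v hv
        by_cases hvW : v = N.W k
        · simp [hvW]
        · rwa [Function.update_of_ne hvW]
      refine ⟨h1.step (hgood k hc1) hc1 hc2 hc3, fun v hv => hne v (h2 v hv), ?_, ?_⟩
      · intro hcl
        exact absurd hc3 (h2 _ (hcl k hc1 (h3 hcl _ hc2)))
      · intro p hp hCp hU
        rcases hp.eq_or_lt with rfl | hp
        · simp
        · exact hne _ (h4 p hp hCp hU)
    · obtain ⟨e1, e2⟩ := Prod.mk.inj e
      rw [e1, e2]
      refine ⟨h1, h2, h3, fun p hp hCp hU => ?_⟩
      rcases hp.eq_or_lt with rfl | hp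
      · intro hW
        exact hc ⟨hCp, h2 _ hU, hW⟩
      · exact h4 p hp hCp hU

theorem eval_clearMarks (σ : Store) : ∀ v < σ.reg 0, (clearMarks.eval σ).arr 8 v = 0 := by
  have key := rep_induction (x := 22) (P := store 8 22 10) (fun k τ =>
      ∀ v < σ.reg 0, k ≤ v → τ.arr 8 v = 0) (σ.setReg 10 0) ?_ ?_
  · exact fun v hv => key v hv (Nat.zero_le _)
  · intro v hv hv'
    simp at hv'
    omega
  · intro k hk τ hreg harr hJ v hv hkv
    have h10 : τ.reg 10 = 0 := by rw [hreg 10 (by decide)]; simp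
    simp only [eval_store, Store.arr_setArr, if_true, Store.arr_setReg, Store.reg_setReg]
    by_cases hvk : v = k
    · simp [hvk, h10]
    · rw [Function.update_of_ne hvk]
      exact hJ v hv (by omega)

theorem eval_search {C : ℕ → ℕ} (hgood : ∀ p, C p ≠ 0 → N.good p) {σ : Store} (h : N.Holds σ)
    (hC : σ.arr 7 = C) (hpar : σ.arr 9 N.r = 0) (h1 : σ.reg 1 = 1) :
    N.IsSearch C ((search.eval σ).arr 8) ((search.eval σ).arr 9) ∧
      N.Closed C ((search.eval σ).arr 8) := by
  set σ₁ := (clearMarks ;; store 8 4 1).eval σ with hσ₁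
  have e : search.eval σ = (rep 22 pass).eval σ₁ := rfl
  have hH : N.Holds σ₁ := h.eval (by decide)
  have hC₁ : σ₁.arr 7 = C := (eval_arr _ (by decide) σ).trans hC
  have hreg4 : (clearMarks.eval σ).reg 4 = N.r := (eval_reg _ (by decide) σ).trans h.reg_r
  have hmark : ∀ v < N.n, σ₁.arr 8 v = if v = N.r then 1 else 0 := by
    intro v hv
    have h0 := eval_clearMarks σ v (by rw [h.reg_L]; exact hv.trans_le N.n_le)
    have hreg1 : (clearMarks.eval σ).reg 1 = 1 := by
      have : 0 < σ.reg 0 := by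
        rw [h.reg_L]
        exact (Nat.zero_le _).trans_lt (hv.trans_le N.n_le)
      have key := rep_induction (x := 22) (P := store 8 22 10) (fun k τ => τ.reg 1 = 1)
        (σ.setReg 10 0) (by simpa using h1) (by intros; simp)
      exact key
    simp only [hσ₁, eval_seq, eval_store, Store.arr_setArr, if_true, hreg4, hreg1,
      Function.update_apply, h0]
  have hsearch : N.IsSearch C (σ₁.arr 8) (σ₁.arr 9) := by
    have hr := hmark N.r N.r_lt
    rw [if_pos rfl] at hr
    refine ⟨?_, hr, ?_, ?_⟩
    · rw [hσ₁, eval_arr _ (by decide) σ, hpar]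
    · intro v hv hm hvr
      rw [hmark v hv, if_neg hvr] at hm
      exact absurd rfl hm
    · intro v hv
      rw [hmark v hv]
      have := one_le_count (N := N) (mark := σ₁.arr 8) (by omega)
      split_ifs <;> omega
  -- Every pass closes the set or marks another vertex. If the set were still not closed after `L`
  -- passes, more than `L ≥ n` vertices would be marked.
  have key := rep_induction (x := 22) (P := pass) (fun k τ =>
      N.IsSearch C (τ.arr 8) (τ.arr 9) ∧ k ≤ N.L ∧
      (N.Closed C (τ.arr 8) ∨ N.L + 1 ≤ N.count (τ.arr 8) + k)) σ₁ ?_ ?_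
  · rw [e]
    refine ⟨key.1, key.2.2.resolve_right fun hle => ?_⟩
    have := (count_le (N := N) (((rep 22 pass).eval σ₁).arr 8)).trans N.n_le
    omega
  · refine ⟨hsearch, hH.reg_L.le, .inr ?_⟩
    have := one_le_count (N := N) (mark := σ₁.arr 8) (by have := hsearch.mark_root; omega)
    rw [hH.reg_L]
    simp only [Store.arr_setReg]
    omega
  · intro k hk τ hreg harr ⟨hs, hkL, hcl⟩
    have hHτ : N.Holds τ := hH.of_rep (by decide) hreg harr
    obtain ⟨h2, h3⟩ := eval_pass hgood (σ := (τ.setReg 1 1).setReg 22 k)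
      ((hHτ.setReg (by decide) (by decide)).setReg (by decide) (by decide))
      ((harr 7 (by decide)).trans hC₁) hs
    refine ⟨h2, by omega, ?_⟩
    simp only [Store.arr_setReg] at h3
    rcases h3 with h3 | ⟨h3, h4⟩
    · exact .inl h3
    · rcases hcl with hcl | hcl
      · exact absurd hcl h3
      · right
        omega

end Net

end RAM

/-! ### Augmentation, minimum cuts and the test of all terminals -/

namespace RAM

open Code

/-- Reverse the arc from the parent of the vertex in register `12`, and go to the parent. -/
def stepBack : Code :=
  load 10 9 12 ;; branch 10
    (load 11 7 10 ;; sub 11 11 1 ;; store 7 10 11 ;; load 13 4 10 ;; load 11 7 13 ;;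
      add 11 11 1 ;; store 7 13 11 ;; load 12 2 10)
    skip

/-- Reverse the arcs of the path from the root to the vertex in register `20`. -/
def augment : Code := copy 12 20 ;; rep 22 stepBack

/-- Copy the array `5` to the array `7`. -/
def loadCapacities : Code := rep 21 (load 10 5 21 ;; store 7 21 10)

/-- Search for a path from the root to the vertex in register `20` and augment. -/
def augmentStep : Code :=
  search ;; load 10 8 20 ;; branch 10 (add 7 7 1 ;; augment) skip

/-- Compute the minimum capacity of a cut between the root and the vertex in register `20`. -/
def minCut : Code := loadCapacities ;; const 7 0 ;; rep 21 augmentStep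

/-- Compare the minimum cut of a terminal with the threshold in register `5`. -/
def checkTerminal : Code :=
  load 10 6 20 ;; branch 10 (minCut ;; sub 10 5 7 ;; branch 10 (const 6 0) skip) skip

/-- Compare all minimum cuts between the root and a terminal with the threshold. -/
def checkAll : Code := const 6 1 ;; rep 20 checkTerminal

namespace Net

variable {N : Net}

theorem eval_stepBack {σ : Store} (h : N.Holds σ) (h1 : σ.reg 1 = 1) :
    let v := σ.reg 12
    let p := σ.arr 9 v
    let C := Function.update (σ.arr 7) p (σ.arr 7 p - 1)
    (stepBack.eval σ).arr 7 =
        (if p ≠ 0 then Function.update C (N.R p) (C (N.R p) + 1) else σ.arr 7) ∧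
      (stepBack.eval σ).reg 12 = if p ≠ 0 then N.U p else v := by
  intro v p C
  by_cases hp : p = 0
  · have hp' : σ.arr 9 (σ.reg 12) = 0 := hp
    simp [stepBack, hp', p, v]
  · have hp' : σ.arr 9 (σ.reg 12) ≠ 0 := hp
    simp [stepBack, hp', p, v, C, h.arr_R, h.arr_U, h1]

/-- The change, head in `X` minus tail in `X`, telescopes along a path. Since `C'` is read after the
decrement, `R p = p` is allowed; this occurs for the diagonal of the matrix. -/
theorem cut_reverse {C : ℕ → ℕ} {p : ℕ} (hg : N.good p) (hC : C p ≠ 0) (X : Finset ℕ) :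
    let C' := Function.update C p (C p - 1)
    N.cut (Function.update C' (N.R p) (C' (N.R p) + 1)) X + (if N.U p ∈ X then 1 else 0) =
      N.cut C X + if N.W p ∈ X then 1 else 0 := by
  intro C'
  have e1 := cut_update (C := C) (c := C p - 1) (N.good_lt p hg) X
  have e2 := cut_update (C := C') (c := C' (N.R p) + 1) (N.good_lt _ (N.good_R p hg)) X
  rw [N.U_R p hg, N.W_R p hg] at e2
  change N.cut C' X + _ = _ at e1
  by_cases hU : N.U p ∈ X <;> by_cases hW : N.W p ∈ X <;> simp [hU, hW] at e1 e2 ⊢ <;> omega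

theorem eval_augment {C : ℕ → ℕ} (hgood : ∀ p, C p ≠ 0 → N.good p) {σ : Store} (h : N.Holds σ)
    (hC : σ.arr 7 = C) (hs : N.IsSearch C (σ.arr 8) (σ.arr 9)) (ht : σ.reg 20 < N.n)
    (hmark : σ.arr 8 (σ.reg 20) ≠ 0) :
    (∀ p, (augment.eval σ).arr 7 p ≠ 0 → N.good p) ∧
      ∀ X : Finset ℕ, N.r ∈ X → σ.reg 20 ∉ X →
        N.cut ((augment.eval σ).arr 7) X + 1 = N.cut C X := by
  set mark := σ.arr 8
  set par := σ.arr 9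
  set t := σ.reg 20
  -- Register `12` holds the current vertex on the way from `t` to the root. The bound `k + 1` on
  -- its mark forces the root at `k = 0`; there the remaining rounds do nothing. The tree arcs from
  -- the current vertex downwards in mark are unused so far, and the cut formula is the telescoped
  -- `cut_reverse`.
  have key := rep_induction (x := 22) (P := stepBack) (fun k τ =>
    (∀ p, τ.arr 7 p ≠ 0 → N.good p) ∧ τ.reg 12 < N.n ∧ mark (τ.reg 12) ≠ 0 ∧
    mark (τ.reg 12) ≤ k + 1 ∧
    (∀ v < N.n, mark v ≠ 0 → v ≠ N.r → mark v ≤ mark (τ.reg 12) → τ.arr 7 (par v) ≠ 0) ∧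
    ∀ X : Finset ℕ, N.r ∈ X → t ∉ X →
      N.cut (τ.arr 7) X + 1 = N.cut C X + if τ.reg 12 ∈ X then 0 else 1) (σ.setReg 12 t) ?_ ?_
  · change (∀ p, (augment.eval σ).arr 7 p ≠ 0 → _) ∧ (augment.eval σ).reg 12 < _ ∧ _ at key
    obtain ⟨h1, h2, h3, h4, h5, h6⟩ := key
    have hr : (augment.eval σ).reg 12 = N.r := by
      by_contra hne
      obtain ⟨-, -, -, h7, h8⟩ := hs.par_spec _ h2 h3 hne
      change mark ((augment.eval σ).reg 12) ≤ _ at h4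
      omega
    refine ⟨h1, fun X hr' htX => ?_⟩
    have := h6 X hr' htX
    change N.cut ((augment.eval σ).arr 7) X + 1 = _ + if (augment.eval σ).reg 12 ∈ X then _ else _
      at this
    simpa [hr, hr'] using this
  · have e : ((σ.setReg 12 t).setReg 22 ((σ.setReg 12 t).reg 0)).reg 12 = t := by simp
    rw [e]
    refine ⟨by simpa [hC] using hgood, ht, hmark, ?_, ?_, ?_⟩
    · have := (hs.mark_le t ht).trans ((count_le mark).trans N.n_le)
      simp [h.reg_L]
      omega
    · intro v hv hm hvr _
      simpa [hC] using (hs.par_spec v hv hm hvr).2.1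
    · intro X hr htX
      simp [hC, htX]
  · intro k hk τ hreg harr ⟨h1, h2, h3, h4, h5, h6⟩
    have hH : N.Holds τ := Holds.of_rep (σ := σ.setReg 12 t) (h.setReg (by decide) (by decide))
      (by decide) hreg harr
    have h9 : τ.arr 9 = par := harr 9 (by decide)
    obtain ⟨e1, e2⟩ := eval_stepBack (σ := (τ.setReg 1 1).setReg 22 k)
      ((hH.setReg (by decide) (by decide)).setReg (by decide) (by decide)) (by simp)
    have e0 : ((τ.setReg 1 1).setReg 22 k).reg 12 = τ.reg 12 := by simp
    simp only [e0, Store.arr_setReg, h9] at e1 e2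
    generalize τ.reg 12 = v at *
    generalize τ.arr 7 = C₁ at *
    rw [e1, e2]
    by_cases hvr : v = N.r
    · have : par v = 0 := hvr ▸ hs.par_root
      have hm : mark v = 1 := hvr ▸ hs.mark_root
      simp only [this, ne_eq, not_true, if_false]
      exact ⟨h1, h2, h3, by omega, h5, h6⟩
    · obtain ⟨g1, -, g3, g4, g5⟩ := hs.par_spec v h2 h3 hvr
      have hp := h5 v h2 h3 hvr le_rfl
      simp only [ne_eq, N.good_ne _ g1, not_false_iff, if_true]
      refine ⟨fun q hq => ?_, N.U_lt _ g1, g4, by omega, ?_, fun X hr htX => ?_⟩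
      · by_cases hqR : q = N.R (par v)
        · exact hqR ▸ N.good_R _ g1
        · rw [Function.update_of_ne hqR] at hq
          by_cases hqp : q = par v
          · exact hqp ▸ g1
          · rw [Function.update_of_ne hqp] at hq
            exact h1 q hq
      · intro w hw hmw hwr hle
        -- The heads of the two arcs differ because their marks do. If the tree arc to `w` is the
        -- reverse of the arc just used, its capacity has only grown.
        have hne : par w ≠ par v := by
          intro e
          have := (hs.par_spec w hw hmw hwr).2.2.1
          rw [e, g3] at this
          subst this
          omega
        by_cases hqR : par w = N.R (par v)
        · rw [hqR, Function.update_self]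
          omega
        · rw [Function.update_of_ne hqR, Function.update_of_ne hne]
          exact h5 w hw hmw hwr (by omega)
      · have c1 := cut_reverse g1 hp X
        have c2 := h6 X hr htX
        simp only [g3] at c1
        generalize N.cut (Function.update (Function.update C₁ (par v) (C₁ (par v) - 1))
          (N.R (par v)) _) X = x at *
        split_ifs at * <;> omega

theorem eval_loadCapacities (σ : Store) (p : ℕ) :
    (loadCapacities.eval σ).arr 7 p = if p < σ.reg 0 then σ.arr 5 p else σ.arr 7 p := by
  have key := rep_induction (x := 21) (P := load 10 5 21 ;; store 7 21 10) (fun k τ =>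
    ∀ p, τ.arr 7 p = if k ≤ p ∧ p < σ.reg 0 then σ.arr 5 p else σ.arr 7 p) σ ?_ ?_
  · simp only [Nat.zero_le, true_and] at key
    exact key p
  · intro p
    rw [if_neg (by omega)]
    rfl
  · intro k hk τ hreg harr hJ p
    have h5 : τ.arr 5 = σ.arr 5 := harr 5 (by decide)
    by_cases hp : p = k
    · subst hp
      simp [h5, hk]
    · have e : (k + 1 ≤ p ∧ p < σ.reg 0) ↔ (k ≤ p ∧ p < σ.reg 0) := by omega
      simp only [← e, ← hJ p]
      simp [Function.update_of_ne hp]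

/-- `k` is the minimum capacity of a cut separating the root from `t`. -/
def IsMinCut (N : Net) (A : ℕ → ℕ) (t k : ℕ) : Prop :=
  (∀ X : Finset ℕ, N.r ∈ X → t ∉ X → k ≤ N.cut A X) ∧
    ∃ X : Finset ℕ, N.r ∈ X ∧ t ∉ X ∧ N.cut A X = k

theorem cut_singleton_le {A : ℕ → ℕ} (hA : ∀ p, A p ≤ 1) (X : Finset ℕ) : N.cut A X ≤ N.L := by
  calc N.cut A X ≤ ∑ p ∈ Finset.range N.L, 1 := by
        refine Finset.sum_le_sum fun p _ => ?_
        split_ifs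
        · exact hA p
        · exact Nat.zero_le _
    _ = N.L := by simp

theorem cut_closed {C mark : ℕ → ℕ} (hgood : ∀ p, C p ≠ 0 → N.good p) (h : N.Closed C mark) :
    N.cut C ((Finset.range N.n).filter fun v => mark v ≠ 0) = 0 := by
  refine Finset.sum_eq_zero fun p _ => ?_
  split_ifs with hp
  · by_contra hC
    have hg := hgood p hC
    simp only [Finset.mem_filter, Finset.mem_range, not_and] at hp
    exact hp.2 (N.W_lt p hg) (h p hC hp.1.2)
  · rfl

theorem eval_minCut {A : ℕ → ℕ} (hgood : ∀ p, A p ≠ 0 → N.good p) (hA : ∀ p, A p ≤ 1)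
    {σ : Store} (h : N.Holds σ) (h5 : σ.arr 5 = A) (h7 : ∀ p, σ.arr 7 p ≠ 0 → N.good p)
    (h9 : σ.arr 9 N.r = 0) (ht : σ.reg 20 < N.n) (htr : σ.reg 20 ≠ N.r) :
    (∀ p, (minCut.eval σ).arr 7 p ≠ 0 → N.good p) ∧ (minCut.eval σ).arr 9 N.r = 0 ∧
      N.IsMinCut A (σ.reg 20) ((minCut.eval σ).reg 7) := by
  set σ₁ := (loadCapacities ;; const 7 0).eval σ with hσ₁
  have hH₁ : N.Holds σ₁ := h.eval (by decide)
  have h20 : σ₁.reg 20 = σ.reg 20 := eval_reg _ (by decide) σ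
  have h7₁ : σ₁.arr 7 = A := by
    funext p
    have := eval_loadCapacities σ p
    simp only [hσ₁, eval_seq, eval_const, Store.arr_setReg, this, h5]
    -- Old residual capacities are overwritten below `L`; beyond `L` both arrays vanish, as neither
    -- is supported there.
    split_ifs with hp
    · rfl
    · rw [h.reg_L] at hp
      have hng : ¬ N.good p := fun hg => hp (N.good_lt p hg)
      rw [not_imp_comm.1 (h7 p) hng, not_imp_comm.1 (hgood p) hng]
  have h9₁ : σ₁.arr 9 N.r = 0 := by
    rw [hσ₁, eval_arr _ (by decide) σ, h9]
  generalize σ.reg 20 = t at *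
  -- Register `7` counts the augmentations: every cut between the root and `t` has lost exactly this
  -- much. Until a residual cut vanishes, each round augments.
  have key := rep_induction (x := 21) (P := augmentStep) (fun k τ =>
    (∀ p, τ.arr 7 p ≠ 0 → N.good p) ∧ τ.arr 9 N.r = 0 ∧
    (∀ X : Finset ℕ, N.r ∈ X → t ∉ X → N.cut (τ.arr 7) X + τ.reg 7 = N.cut A X) ∧
    ((∃ X : Finset ℕ, N.r ∈ X ∧ t ∉ X ∧ N.cut (τ.arr 7) X = 0) ∨ τ.reg 7 + k = N.L)) σ₁ ?_ ?_
  · change (∀ p, (minCut.eval σ).arr 7 p ≠ 0 → _) ∧ (minCut.eval σ).arr 9 N.r = 0 ∧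
      (∀ X : Finset ℕ, N.r ∈ X → t ∉ X → N.cut ((minCut.eval σ).arr 7) X +
        (minCut.eval σ).reg 7 = _) ∧ ((∃ X : Finset ℕ, _ ∧ _ ∧
        N.cut ((minCut.eval σ).arr 7) X = 0) ∨ (minCut.eval σ).reg 7 + 0 = _) at key
    obtain ⟨k1, k2, k3, k4⟩ := key
    refine ⟨k1, k2, fun X hr htX => by have := k3 X hr htX; omega, ?_⟩
    rcases k4 with ⟨X, hr, htX, hX⟩ | k4
    · exact ⟨X, hr, htX, by have := k3 X hr htX; omega⟩
    -- After `L` augmentations the cut of `{r}`, whose capacity was at most `L`, is exhausted.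
    · refine ⟨{N.r}, by simp, by simpa using htr, ?_⟩
      have := k3 {N.r} (by simp) (by simpa using htr)
      have := cut_singleton_le hA (N := N) {N.r}
      omega
  · have e : (σ₁.setReg 21 (σ₁.reg 0)).reg 7 = 0 := by simp [hσ₁]
    rw [e]
    simp only [Store.arr_setReg, h7₁]
    exact ⟨hgood, h9₁, fun X _ _ => rfl, .inr (by rw [hH₁.reg_L, Nat.zero_add])⟩
  · intro k hk τ hreg harr ⟨k1, k2, k3, k4⟩
    have hHτ : N.Holds τ := hH₁.of_rep (by decide) hreg harr
    have ht20 : τ.reg 20 = t := (hreg 20 (by decide)).trans h20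
    set τ₁ := (τ.setReg 1 1).setReg 21 k with hτ₁
    have hHτ₁ : N.Holds τ₁ := (hHτ.setReg (by decide) (by decide)).setReg (by decide) (by decide)
    have hone : τ₁.reg 1 = 1 := by simp [hτ₁]
    obtain ⟨s1, s2⟩ := eval_search k1 hHτ₁ rfl k2 hone
    set τ₂ := search.eval τ₁ with hτ₂
    have hHτ₂ : N.Holds τ₂ := hHτ₁.eval (by decide)
    have hone₂ : τ₂.reg 1 = 1 := eval_reg_one _ (by decide) hone
    have h7₂ : τ₂.arr 7 = τ.arr 7 := eval_arr _ (by decide) τ₁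
    have hr7₂ : τ₂.reg 7 = τ.reg 7 := by
      rw [hτ₂, eval_reg _ (by decide)]
      simp [hτ₁]
    have ht₂ : τ₂.reg 20 = t := by
      rw [hτ₂, eval_reg _ (by decide)]
      simp [hτ₁, ht20]
    have e : augmentStep.eval τ₁ = if τ₂.arr 8 t ≠ 0 then
        augment.eval ((τ₂.setReg 10 (τ₂.arr 8 t)).setReg 7 (τ.reg 7 + 1)) else
        τ₂.setReg 10 (τ₂.arr 8 t) := by
      simp only [augmentStep, eval_seq, ← hτ₂, eval_load, ht₂, eval_branch, eval_add, eval_skip]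
      simp [hone₂, hr7₂]
    rw [e]
    split_ifs with hm
    · set τ₃ := (τ₂.setReg 10 (τ₂.arr 8 t)).setReg 7 (τ.reg 7 + 1) with hτ₃
      have ht₃ : τ₃.reg 20 = t := by simp [hτ₃, ht₂]
      obtain ⟨a1, a2⟩ := eval_augment (σ := τ₃) k1
        ((hHτ₂.setReg (by decide) (by decide)).setReg (by decide) (by decide))
        h7₂ s1 (ht₃ ▸ ht) (by rw [ht₃]; exact hm)
      rw [ht₃] at a2
      have hr7 : (augment.eval τ₃).reg 7 = τ.reg 7 + 1 := by
        rw [eval_reg _ (by decide)]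
        simp [hτ₃]
      have hr9 : (augment.eval τ₃).arr 9 = τ₂.arr 9 := eval_arr _ (by decide) τ₃
      refine ⟨a1, by rw [hr9]; exact s1.par_root, fun X hr htX => ?_, ?_⟩
      · have b2 := a2 X hr htX
        have b3 := k3 X hr htX
        change _ = N.cut (τ.arr 7) X at b2
        omega
      · rcases k4 with ⟨X, hr, htX, hX⟩ | k4
        -- A cut of capacity `0` cannot lose a unit, so no augmentation happens after one has
        -- appeared.
        · have := a2 X hr htX
          change _ = N.cut (τ.arr 7) X at this
          omega
        · right
          omega
    · have hr7 : (τ₂.setReg 10 (τ₂.arr 8 t)).reg 7 = τ.reg 7 := by simp [hr7₂]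
      rw [hr7]
      simp only [Store.arr_setReg, h7₂]
      refine ⟨k1, s1.par_root, k3, .inl ⟨_, ?_, ?_, cut_closed k1 s2⟩⟩
      · simp [N.r_lt, s1.mark_root]
      · simpa [ht] using hm

theorem eval_checkAll {A : ℕ → ℕ} (hgood : ∀ p, A p ≠ 0 → N.good p) (hA : ∀ p, A p ≤ 1)
    {σ : Store} (h : N.Holds σ) (h5 : σ.arr 5 = A) (h7 : ∀ p, σ.arr 7 p ≠ 0 → N.good p)
    (h9 : σ.arr 9 N.r = 0) (hT : ∀ t, σ.arr 6 t ≠ 0 → t < N.n ∧ t ≠ N.r) :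
    let Q := ∀ t, σ.arr 6 t ≠ 0 → ∀ X : Finset ℕ, N.r ∈ X → t ∉ X → σ.reg 5 ≤ N.cut A X
    (Q ∧ (checkAll.eval σ).reg 6 = 1) ∨ (¬ Q ∧ (checkAll.eval σ).reg 6 = 0) := by
  intro Q
  have key := rep_induction (x := 20) (P := checkTerminal) (fun k τ =>
    (∀ p, τ.arr 7 p ≠ 0 → N.good p) ∧ τ.arr 9 N.r = 0 ∧
    ((∀ t, k ≤ t → σ.arr 6 t ≠ 0 → ∀ X : Finset ℕ, N.r ∈ X → t ∉ X → σ.reg 5 ≤ N.cut A X) ∧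
      τ.reg 6 = 1 ∨ ¬ Q ∧ τ.reg 6 = 0)) (σ.setReg 6 1) ?_ ?_
  · obtain ⟨-, -, h | h⟩ := key
    · exact .inl ⟨fun t => h.1 t (Nat.zero_le _), h.2⟩
    · exact .inr h
  · refine ⟨h7, h9, .inl ⟨fun t ht hTt => ?_, by simp⟩⟩
    have := (hT t hTt).1.trans_le N.n_le
    simp [h.reg_L] at ht
    omega
  · intro k hk τ hreg harr ⟨k1, k2, k3⟩
    have hHτ : N.Holds τ := Holds.of_rep (σ := σ.setReg 6 1) (h.setReg (by decide) (by decide))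
      (by decide) hreg harr
    have hℓ : τ.reg 5 = σ.reg 5 := by
      rw [hreg 5 (by decide)]
      simp
    have h6 : τ.arr 6 = σ.arr 6 := harr 6 (by decide)
    have h5τ : τ.arr 5 = A := (harr 5 (by decide)).trans h5
    set τ₁ := ((τ.setReg 1 1).setReg 20 k).setReg 10 (σ.arr 6 k) with hτ₁
    have hk₁ : τ₁.reg 20 = k := by simp [hτ₁]
    have e : checkTerminal.eval ((τ.setReg 1 1).setReg 20 k) =
        if σ.arr 6 k ≠ 0 then
          (sub 10 5 7 ;; branch 10 (const 6 0) skip).eval (minCut.eval τ₁) else τ₁ := by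
      simp only [checkTerminal, eval_seq, eval_load, eval_branch, Store.arr_setReg, h6, eval_skip]
      simp [hτ₁]
    rw [e]
    split_ifs with hTk
    · obtain ⟨m1, m2, m3⟩ := eval_minCut hgood hA (σ := τ₁)
        (((hHτ.setReg (by decide) (by decide)).setReg (by decide) (by decide)).setReg
          (by decide) (by decide)) h5τ k1 k2 (by rw [hk₁]; exact (hT k hTk).1)
        (by rw [hk₁]; exact (hT k hTk).2)
      rw [hk₁] at m3
      have r5 : (minCut.eval τ₁).reg 5 = σ.reg 5 := by
        rw [eval_reg _ (by decide)]
        simp [hτ₁, hℓ]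
      have r6 : (minCut.eval τ₁).reg 6 = τ.reg 6 := by
        rw [eval_reg _ (by decide)]
        simp [hτ₁]
      set τ₂ := minCut.eval τ₁
      obtain ⟨m3, X, hr, hkX, hX⟩ := m3
      by_cases hle : σ.reg 5 ≤ τ₂.reg 7
      · have e2 : (sub 10 5 7 ;; branch 10 (const 6 0) skip).eval τ₂ = τ₂.setReg 10 0 := by
          simp only [eval_seq, eval_sub, eval_branch, eval_skip, Store.reg_setReg, r5,
            Nat.sub_eq_zero_of_le hle, ne_eq, not_true, if_true, if_false]
        rw [e2]
        refine ⟨m1, m2, ?_⟩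
        simp only [Store.reg_setReg, r6]
        refine k3.imp_left fun ⟨h1, h2⟩ => ⟨fun t hkt hTt X hr htX => ?_, by simpa using h2⟩
        rcases hkt.eq_or_lt with rfl | hkt
        · exact hle.trans (m3 X hr htX)
        · exact h1 t hkt hTt X hr htX
      · have e2 : (sub 10 5 7 ;; branch 10 (const 6 0) skip).eval τ₂ =
            (τ₂.setReg 10 (σ.reg 5 - τ₂.reg 7)).setReg 6 0 := by
          simp [r5, Nat.sub_eq_zero_iff_le, hle]
        rw [e2]
        refine ⟨m1, m2, .inr ⟨fun hQ => hle ?_, by simp⟩⟩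
        rw [← hX]
        exact hQ k hTk X hr hkX
    · refine ⟨k1, k2, ?_⟩
      have : τ₁.reg 6 = τ.reg 6 := by simp [hτ₁]
      rw [this]
      refine k3.imp_left fun ⟨h1, h2⟩ => ⟨fun t hkt hTt => ?_, h2⟩
      rcases hkt.eq_or_lt with rfl | hkt
      · exact absurd hTt hTk
      · exact h1 t hkt hTt

end Net

end RAM

/-! ## Reading the input -/

namespace RAM

open Code

/-- The position of the entry `(u, v)` of the adjacency matrix in the input word. -/
def pos (n u v : ℕ) : ℕ := n + 1 + u * n + v

theorem pos_inj {n u v u' v' : ℕ} (hv : v < n) (hv' : v' < n) (h : pos n u v = pos n u' v') :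
    u = u' ∧ v = v' := by
  unfold pos at h
  have h1 : v + n * u = v' + n * u' := by
    rw [mul_comm n u, mul_comm n u']
    omega
  have hn : 0 < n := by omega
  have h2 := congrArg (· / n) h1
  have h3 := congrArg (· % n) h1
  simp only [Nat.add_mul_div_left _ _ hn, Nat.div_eq_of_lt hv, Nat.div_eq_of_lt hv',
    Nat.add_mul_mod_self_left, Nat.mod_eq_of_lt hv, Nat.mod_eq_of_lt hv'] at h2 h3
  omega

theorem pos_lt {n u v : ℕ} (hu : u < n) (hv : v < n) : pos n u v < n + 1 + n * n := by
  have : (u + 1) * n ≤ n * n := Nat.mul_le_mul_right n hu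
  rw [Nat.succ_mul] at this
  unfold pos
  omega

/-- The bits `f` of a word of length `L` that encodes a digraph with `n` vertices, a set of
vertices, the vertex `r` and the number `ℓ`. -/
structure Layout (f : ℕ → ℕ) (L n r ℓ : ℕ) : Prop where
  r_lt : r < n
  size_one : ∀ i < n, f i = 1
  size_end : f n = 0
  root_one : ∀ i < r, f (n + 1 + n * n + n + i) = 1
  root_end : f (n + 1 + n * n + n + r) = 0
  bits : ∀ i, f (n + 1 + n * n + n + r + 1 + i) = (ℓ.testBit i).toNat
  length : L = n + 1 + n * n + n + r + 1 + ℓ.size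

/-- Read the number of vertices. -/
def readSize : Code := rep 20 (load 10 0 2 ;; add 2 2 10)

/-- Compute the positions of the rows of the matrix. -/
def rowTable : Code :=
  const 11 1 ;; add 11 11 2 ;; const 12 0 ;;
    rep 20 (store 1 12 11 ;; add 11 11 2 ;; add 12 12 1)

/-- Read one entry of the matrix. -/
def arcEntry : Code :=
  sub 10 2 20 ;; branch 10
    (sub 10 2 21 ;; branch 10
      (load 10 1 20 ;; add 10 10 21 ;; load 11 1 21 ;; add 11 11 20 ;; store 2 10 20 ;;
        store 3 10 21 ;; store 4 10 11 ;; load 12 0 10 ;; store 5 10 12)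
      skip)
    skip

/-- Read the matrix. -/
def arcTable : Code := rep 20 (rep 21 arcEntry)

/-- Read the set of vertices. -/
def terminalTable : Code :=
  load 3 1 2 ;; rep 20 (sub 10 2 20 ;; branch 10 (add 10 3 20 ;; load 11 0 10 ;; store 6 20 11) skip)

/-- Read the root, and remove it from the set of vertices. -/
def readRoot : Code :=
  add 3 3 2 ;; rep 20 (load 10 0 3 ;; add 3 3 10 ;; add 4 4 10) ;; const 10 0 ;; store 6 4 10

/-- Read the threshold. -/
def readThreshold : Code :=
  rep 20 (sub 10 20 3 ;; branch 10 (add 5 5 5 ;; load 10 0 20 ;; add 5 5 10) skip)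

/-- Read the input. -/
def readInput : Code :=
  readSize ;; rowTable ;; arcTable ;; terminalTable ;; readRoot ;; readThreshold

section Reading

variable {f : ℕ → ℕ} {L n r ℓ : ℕ} {σ : Store}

/-- The bit at the current position is added to the position, which therefore stops at the first
`0`. `readRoot` uses the same device. -/
theorem eval_readSize (hf : Layout f L n r ℓ) (h0 : σ.arr 0 = f) (hL : σ.reg 0 = L)
    (h2 : σ.reg 2 = 0) : (readSize.eval σ).reg 2 = n := by
  have key := rep_induction (x := 20) (P := load 10 0 2 ;; add 2 2 10) (fun k τ =>
    τ.reg 2 = min n (L - k)) σ ?_ ?_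
  · refine key.trans (min_eq_left ?_)
    have := hf.length
    omega
  · simp [h2, hL]
  · intro k hk τ hreg harr hJ
    have h0' : τ.arr 0 = f := (harr 0 (by decide)).trans h0
    simp [h0', hJ]
    rcases lt_or_ge (L - (k + 1)) n with h | h
    · rw [min_eq_right h.le, hf.size_one _ h]
      omega
    · rw [min_eq_left h, hf.size_end]
      omega

/-- The machine cannot multiply, so the starts of the rows are accumulated by addition. The entry at
`n` is the position just after the matrix. -/
theorem eval_rowTable (h2 : σ.reg 2 = n) :
    ∀ i < σ.reg 0, (rowTable.eval σ).arr 1 i = n + 1 + i * n := by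
  set σ₁ := (const 11 1 ;; add 11 11 2 ;; const 12 0).eval σ with hσ₁
  have hL : σ₁.reg 0 = σ.reg 0 := eval_reg _ (by decide) σ
  have key := rep_induction (x := 20) (P := store 1 12 11 ;; add 11 11 2 ;; add 12 12 1)
    (fun k τ => τ.reg 12 + k = σ.reg 0 ∧ τ.reg 11 = n + 1 + τ.reg 12 * n ∧
      ∀ i < τ.reg 12, τ.arr 1 i = n + 1 + i * n) σ₁ ?_ ?_
  · intro i hi
    exact key.2.2 i (by have := key.1; omega)
  · refine ⟨by simp [hσ₁], ?_, by simp [hσ₁]⟩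
    simp [hσ₁, h2, add_comm]
  · intro k hk τ hreg harr ⟨k1, k2, k3⟩
    have h2' : τ.reg 2 = n := by
      rw [hreg 2 (by decide), hσ₁, eval_reg _ (by decide), h2]
    simp [h2', k2]
    refine ⟨by omega, by ring, fun i hi => ?_⟩
    rcases hi.lt_or_eq with hi | rfl
    · rw [Function.update_of_ne hi.ne, k3 i hi]
    · simp

/-- The entries in `S` of the matrix have been read, and nothing else. -/
structure Filled (f : ℕ → ℕ) (n : ℕ) (S : ℕ → ℕ → Prop) (σ : Store) : Prop where
  tail : ∀ u < n, ∀ v < n, S u v → σ.arr 2 (pos n u v) = u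
  head : ∀ u < n, ∀ v < n, S u v → σ.arr 3 (pos n u v) = v
  rev : ∀ u < n, ∀ v < n, S u v → σ.arr 4 (pos n u v) = pos n v u
  cap : ∀ u < n, ∀ v < n, S u v → σ.arr 5 (pos n u v) = f (pos n u v)
  support : ∀ p, σ.arr 5 p ≠ 0 → ∃ u < n, ∃ v < n, p = pos n u v

theorem Filled.mono {S S' : ℕ → ℕ → Prop} (h : Filled f n S σ)
    (hS : ∀ u < n, ∀ v < n, S' u v → S u v) : Filled f n S' σ :=
  ⟨fun u hu v hv hs => h.tail u hu v hv (hS u hu v hv hs),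
    fun u hu v hv hs => h.head u hu v hv (hS u hu v hv hs),
    fun u hu v hv hs => h.rev u hu v hv (hS u hu v hv hs),
    fun u hu v hv hs => h.cap u hu v hv (hS u hu v hv hs), h.support⟩

theorem update_pos {g : ℕ → ℕ} {c u₀ v₀ : ℕ} {G : ℕ → ℕ → ℕ} {S : ℕ → ℕ → Prop} (hv₀ : v₀ < n)
    (hg : ∀ u < n, ∀ v < n, S u v → g (pos n u v) = G u v) (hc : c = G u₀ v₀) :
    ∀ u < n, ∀ v < n, (S u v ∨ u = u₀ ∧ v = v₀) →
      Function.update g (pos n u₀ v₀) c (pos n u v) = G u v := by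
  intro u hu v hv hs
  by_cases h : u = u₀ ∧ v = v₀
  · obtain ⟨rfl, rfl⟩ := h
    simp [hc]
  · rw [Function.update_of_ne fun e => h (pos_inj hv hv₀ e)]
    exact hg u hu v hv (hs.resolve_right h)

/-- Both counters run below the length of the word, not below `n`; pairs out of range are skipped.
-/
theorem eval_arcEntry {S : ℕ → ℕ → Prop} (h : Filled f n S σ) (h0 : σ.arr 0 = f)
    (h1 : ∀ i < n, σ.arr 1 i = n + 1 + i * n) (h2 : σ.reg 2 = n) :
    Filled f n (fun u v => S u v ∨ u = σ.reg 20 ∧ v = σ.reg 21) (arcEntry.eval σ) := by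
  by_cases hu : σ.reg 20 < n
  swap
  · have e : arcEntry.eval σ = σ.setReg 10 0 := by
      simp only [arcEntry, eval_seq, eval_sub, eval_branch, eval_skip, Store.reg_setReg, h2,
        Nat.sub_eq_zero_of_le (not_lt.1 hu), ne_eq, not_true, if_true, if_false]
    rw [e]
    refine Filled.mono (S := S) ⟨h.1, h.2, h.3, h.4, h.5⟩ fun u hu' v _ hs => ?_
    exact hs.resolve_right fun hs => hu (hs.1 ▸ hu')
  by_cases hv : σ.reg 21 < n
  swap
  · have e : arcEntry.eval σ = (σ.setReg 10 (n - σ.reg 20)).setReg 10 0 := by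
      have : n - σ.reg 20 ≠ 0 := by omega
      simp only [arcEntry, eval_seq, eval_sub, eval_branch, eval_skip, Store.reg_setReg, h2,
        ne_eq, if_true, this, not_false_iff]
      simp [Nat.sub_eq_zero_of_le (not_lt.1 hv)]
    rw [e]
    refine Filled.mono (S := S) ⟨h.1, h.2, h.3, h.4, h.5⟩ fun u _ v hv' hs => ?_
    exact hs.resolve_right fun hs => hv (hs.2 ▸ hv')
  have hu' : ¬ n ≤ σ.reg 20 := not_le.2 hu
  have hv' : ¬ n ≤ σ.reg 21 := not_le.2 hv
  have e : ∀ a, (arcEntry.eval σ).arr a =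
      if a = 5 then Function.update (σ.arr 5) (pos n (σ.reg 20) (σ.reg 21))
        (f (pos n (σ.reg 20) (σ.reg 21)))
      else if a = 4 then Function.update (σ.arr 4) (pos n (σ.reg 20) (σ.reg 21))
        (pos n (σ.reg 21) (σ.reg 20))
      else if a = 3 then Function.update (σ.arr 3) (pos n (σ.reg 20) (σ.reg 21)) (σ.reg 21)
      else if a = 2 then Function.update (σ.arr 2) (pos n (σ.reg 20) (σ.reg 21)) (σ.reg 20)
      else σ.arr a := by
    intro a
    simp [arcEntry, h2, Nat.sub_eq_zero_iff_le, hu', hv', h0, h1 _ hu, h1 _ hv, pos]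
  refine ⟨?_, ?_, ?_, ?_, ?_⟩
  · rw [e 2]
    exact update_pos (G := fun u _ => u) hv h.tail rfl
  · rw [e 3]
    exact update_pos (G := fun _ v => v) hv h.head rfl
  · rw [e 4]
    exact update_pos (G := fun u v => pos n v u) hv h.rev rfl
  · rw [e 5]
    exact update_pos (G := fun u v => f (pos n u v)) hv h.cap rfl
  · intro p hp
    by_cases hpp : p = pos n (σ.reg 20) (σ.reg 21)
    · exact ⟨_, hu, _, hv, hpp⟩
    · rw [e 5, if_pos rfl, Function.update_of_ne hpp] at hp
      exact h.support p hp

theorem eval_arcTable (h0 : σ.arr 0 = f) (h1 : ∀ i < n, σ.arr 1 i = n + 1 + i * n)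
    (h2 : σ.reg 2 = n) (hn : n ≤ σ.reg 0) (h5 : ∀ p, σ.arr 5 p = 0) :
    Filled f n (fun _ _ => True) (arcTable.eval σ) := by
  have key := rep_induction (x := 20) (P := rep 21 arcEntry) (fun k τ =>
    Filled f n (fun u _ => k ≤ u) τ) σ ?_ ?_
  · exact key.mono fun u _ v _ _ => Nat.zero_le u
  · refine ⟨?_, ?_, ?_, ?_, fun p hp => absurd (h5 p) hp⟩ <;> intros <;> omega
  · intro k hk τ hreg harr hJ
    have h0' : τ.arr 0 = f := (harr 0 (by decide)).trans h0
    have h1' : τ.arr 1 = σ.arr 1 := harr 1 (by decide)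
    have h2' : τ.reg 2 = n := (hreg 2 (by decide)).trans h2
    have hL' : τ.reg 0 = σ.reg 0 := hreg 0 (by decide)
    set τ₁ := (τ.setReg 1 1).setReg 20 k with hτ₁
    have key := rep_induction (x := 21) (P := arcEntry) (fun j υ =>
      Filled f n (fun u v => k + 1 ≤ u ∨ u = k ∧ j ≤ v) υ) τ₁ ?_ ?_
    · exact key.mono fun u _ v _ hu => by omega
    · refine Filled.mono (S := fun u _ => k + 1 ≤ u) ⟨hJ.1, hJ.2, hJ.3, hJ.4, hJ.5⟩ ?_
      intro u _ v hv hs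
      have : τ₁.reg 0 = σ.reg 0 := by simp [hτ₁, hL']
      omega
    · intro j hj υ hreg' harr' hJ'
      have h20 : υ.reg 20 = k := by
        rw [hreg' 20 (by decide)]
        simp [hτ₁]
      have := eval_arcEntry (σ := (υ.setReg 1 1).setReg 21 j) (n := n) (f := f)
        (S := fun u v => k + 1 ≤ u ∨ u = k ∧ j + 1 ≤ v) ⟨hJ'.1, hJ'.2, hJ'.3, hJ'.4, hJ'.5⟩
        ((harr' 0 (by decide)).trans h0')
        (fun i hi => by
          have : υ.arr 1 = τ₁.arr 1 := harr' 1 (by decide)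
          simp only [Store.arr_setReg, this, hτ₁, h1', h1 i hi])
        (by
          have : υ.reg 2 = τ₁.reg 2 := hreg' 2 (by decide)
          simp [this, hτ₁, h2'])
      refine this.mono fun u _ v _ hs => ?_
      have e20 : ((υ.setReg 1 1).setReg 21 j).reg 20 = k := by simp [h20]
      have e21 : ((υ.setReg 1 1).setReg 21 j).reg 21 = j := by simp
      rw [e20, e21]
      omega

theorem eval_terminalTable (h0 : σ.arr 0 = f) (h1 : σ.arr 1 n = n + 1 + n * n)
    (h2 : σ.reg 2 = n) (hn : n ≤ σ.reg 0) (h6 : ∀ v, σ.arr 6 v = 0) :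
    (terminalTable.eval σ).reg 3 = n + 1 + n * n ∧
      ∀ v, (terminalTable.eval σ).arr 6 v = if v < n then f (n + 1 + n * n + v) else 0 := by
  set σ₁ := (load 3 1 2).eval σ with hσ₁
  have h3 : σ₁.reg 3 = n + 1 + n * n := by simp [hσ₁, h1, h2]
  have key := rep_induction (x := 20)
    (P := sub 10 2 20 ;; branch 10 (add 10 3 20 ;; load 11 0 10 ;; store 6 20 11) skip)
    (fun k τ => ∀ v, τ.arr 6 v = if k ≤ v ∧ v < n then f (n + 1 + n * n + v) else 0) σ₁ ?_ ?_
  · refine ⟨(eval_reg (y := 3) (rep 20 _) (by decide) σ₁).trans h3, fun v => ?_⟩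
    simp only [Nat.zero_le, true_and] at key
    exact key v
  · intro v
    have : σ₁.reg 0 = σ.reg 0 := eval_reg _ (by decide) σ
    rw [if_neg (by omega)]
    exact h6 v
  · intro k hk τ hreg harr hJ v
    have h0' : τ.arr 0 = f := (harr 0 (by decide)).trans h0
    have h2' : τ.reg 2 = n := by
      rw [hreg 2 (by decide), hσ₁, eval_reg _ (by decide), h2]
    have h3' : τ.reg 3 = n + 1 + n * n := (hreg 3 (by decide)).trans h3
    by_cases hkn : n ≤ k
    · simp [h2', Nat.sub_eq_zero_of_le hkn, hJ]
      congr 1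
      simp
      omega
    · simp [h2', h3', h0', Nat.sub_eq_zero_iff_le, hkn]
      by_cases hvk : v = k
      · subst hvk
        simp [not_le.1 hkn]
      · rw [Function.update_of_ne hvk, hJ]
        congr 1
        simp
        omega

theorem eval_readRoot (hf : Layout f L n r ℓ) (h0 : σ.arr 0 = f) (hL : σ.reg 0 = L)
    (h2 : σ.reg 2 = n) (h3 : σ.reg 3 = n + 1 + n * n) (h4 : σ.reg 4 = 0) :
    (readRoot.eval σ).reg 3 = n + 1 + n * n + n + r ∧ (readRoot.eval σ).reg 4 = r ∧
      (readRoot.eval σ).arr 6 = Function.update (σ.arr 6) r 0 := by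
  set σ₁ := (add 3 3 2).eval σ with hσ₁
  have hL₁ : σ₁.reg 0 = L := by simp [hσ₁, hL]
  have key := rep_induction (x := 20) (P := load 10 0 3 ;; add 3 3 10 ;; add 4 4 10)
    (fun k τ => τ.reg 4 = min r (L - k) ∧ τ.reg 3 = n + 1 + n * n + n + min r (L - k)) σ₁ ?_ ?_
  · set σ₂ := (rep 20 (load 10 0 3 ;; add 3 3 10 ;; add 4 4 10)).eval σ₁ with hσ₂
    have e : readRoot.eval σ = (σ₂.setReg 10 0).setArr 6 (σ₂.reg 4) 0 := by
      simp [readRoot, hσ₂, hσ₁]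
    have hr : min r (L - 0) = r := by
      have := hf.length
      omega
    rw [hr] at key
    have h6 : σ₂.arr 6 = σ.arr 6 := (eval_arr (rep 20 _) (by decide) σ₁).trans rfl
    rw [e]
    exact ⟨by simp [key.2], by simp [key.1], by simp [key.1, h6]⟩
  · simp [hL₁]
    simp [hσ₁, h4, h3, h2]
  · intro k hk τ hreg harr ⟨k1, k2⟩
    have h0' : τ.arr 0 = f := (harr 0 (by decide)).trans h0
    simp [h0', k1, k2]
    rcases lt_or_ge (L - (k + 1)) r with h | h
    · rw [min_eq_right h.le, hf.root_one _ h]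
      omega
    · rw [min_eq_left h, hf.root_end]
      omega

theorem eval_readThreshold (hf : Layout f L n r ℓ) (h0 : σ.arr 0 = f) (hL : σ.reg 0 = L)
    (h3 : σ.reg 3 = n + 1 + n * n + n + r) (h5 : σ.reg 5 = 0) :
    (readThreshold.eval σ).reg 5 = ℓ := by
  obtain ⟨q, hq⟩ : ∃ q, q = n + 1 + n * n + n + r := ⟨_, rfl⟩
  have hbits := hf.bits
  have hlen := hf.length
  rw [← hq] at h3 hbits hlen
  -- Horner's rule: the counter descends and the least significant bit comes first, so bits arrive
  -- from the most significant one. For `k ≤ q` the truncated exponent is `0` and the value stays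
  -- `ℓ`.
  have key := rep_induction (x := 20)
    (P := sub 10 20 3 ;; branch 10 (add 5 5 5 ;; load 10 0 20 ;; add 5 5 10) skip)
    (fun k τ => τ.reg 5 = ℓ / 2 ^ (k - (q + 1))) σ ?_ ?_
  · refine key.trans ?_
    simp
  · have : L - (q + 1) = ℓ.size := by omega
    simp [hL, h5, this]
    exact (Nat.div_eq_of_lt (Nat.lt_size_self ℓ)).symm
  · intro k hk τ hreg harr hJ
    have h0' : τ.arr 0 = f := (harr 0 (by decide)).trans h0
    have h3' : τ.reg 3 = q := (hreg 3 (by decide)).trans h3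
    by_cases hkq : k ≤ q
    · have e1 : k + 1 - (q + 1) = 0 := by omega
      have e2 : k - (q + 1) = 0 := by omega
      rw [e1] at hJ
      simp [h3', Nat.sub_eq_zero_of_le hkq, hJ, e2]
    · obtain ⟨i, rfl⟩ : ∃ i, k = q + 1 + i := ⟨k - (q + 1), by omega⟩
      have e1 : q + 1 + i + 1 - (q + 1) = i + 1 := by omega
      have e2 : q + 1 + i - (q + 1) = i := by omega
      rw [e1] at hJ
      have hb : (ℓ.testBit i).toNat = ℓ / 2 ^ i % 2 := Nat.toNat_testBit ℓ i
      simp [h3', Nat.sub_eq_zero_iff_le, h0', hkq, hJ, hbits, hb, e2]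
      rw [pow_succ, ← Nat.div_div_eq_div_mul]
      omega

end Reading

/-- What the memory holds after reading the input. -/
structure InputRead (f : ℕ → ℕ) (L n r ℓ : ℕ) (σ : Store) : Prop where
  reg_L : σ.reg 0 = L
  reg_r : σ.reg 4 = r
  reg_ℓ : σ.reg 5 = ℓ
  filled : Filled f n (fun _ _ => True) σ
  terminals : ∀ v, σ.arr 6 v = if v < n ∧ v ≠ r then f (n + 1 + n * n + v) else 0
  arr_seven : ∀ i, σ.arr 7 i = 0
  arr_nine : ∀ i, σ.arr 9 i = 0

theorem eval_readInput {w : List Bool} {n r ℓ : ℕ}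
    (hf : Layout (fun i => (w.getD i false).toNat) w.length n r ℓ) :
    InputRead (fun i => (w.getD i false).toNat) w.length n r ℓ (readInput.eval (initial w)) := by
  set f : ℕ → ℕ := fun i => (w.getD i false).toNat with hfdef
  set L := w.length with hL
  set σ₀ := initial w with hσ₀
  have hz : ∀ a ≠ 0, ∀ i, σ₀.arr a i = 0 := fun a ha i => by simp [hσ₀, initial, ha]
  have hrz : ∀ x ≠ 0, σ₀.reg x = 0 := fun x hx => by simp [hσ₀, initial, hx]
  have hf0 : σ₀.arr 0 = f := by
    funext i
    simp [hσ₀, initial, hfdef]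
  have hL0 : σ₀.reg 0 = L := by simp [hσ₀, initial, hL]
  have hlen := hf.length
  have hnL : n < L := by omega
  set σ₁ := readSize.eval σ₀ with hσ₁
  have h2₁ : σ₁.reg 2 = n := eval_readSize hf hf0 hL0 (hrz 2 (by decide))
  have hL₁ : σ₁.reg 0 = L := (eval_reg _ (by decide) σ₀).trans hL0
  set σ₂ := rowTable.eval σ₁ with hσ₂
  have h1₂ : ∀ i < L, σ₂.arr 1 i = n + 1 + i * n := hL₁ ▸ eval_rowTable h2₁
  have h2₂ : σ₂.reg 2 = n := (eval_reg _ (by decide) σ₁).trans h2₁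
  have hL₂ : σ₂.reg 0 = L := (eval_reg _ (by decide) σ₁).trans hL₁
  have harr₂ : ∀ a ≠ 1, σ₂.arr a = σ₀.arr a := fun a ha =>
    (eval_arr _ (by simp [rowTable, keepsArr, ha.symm]) σ₁).trans
      (eval_arr _ (by simp [readSize, keepsArr]) σ₀)
  set σ₃ := arcTable.eval σ₂ with hσ₃
  have hfill : Filled f n (fun _ _ => True) σ₃ := eval_arcTable ((harr₂ 0 (by decide)).trans hf0)
    (fun i hi => h1₂ i (by omega)) h2₂ (by omega)
    (fun p => by rw [harr₂ 5 (by decide), hz 5 (by decide)])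
  have h0₃ : σ₃.arr 0 = f :=
    (eval_arr _ (by decide) σ₂).trans ((harr₂ 0 (by decide)).trans hf0)
  have h1₃ : σ₃.arr 1 n = n + 1 + n * n := by
    rw [hσ₃, eval_arr _ (by decide), h1₂ n hnL]
  have h2₃ : σ₃.reg 2 = n := (eval_reg _ (by decide) σ₂).trans h2₂
  have hL₃ : σ₃.reg 0 = L := (eval_reg _ (by decide) σ₂).trans hL₂
  set σ₄ := terminalTable.eval σ₃ with hσ₄
  obtain ⟨h3₄, h6₄⟩ : σ₄.reg 3 = n + 1 + n * n ∧
      ∀ v, σ₄.arr 6 v = if v < n then f (n + 1 + n * n + v) else 0 :=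
    eval_terminalTable h0₃ h1₃ h2₃ (by omega) (fun v => by
      rw [hσ₃, eval_arr _ (by decide), harr₂ 6 (by decide), hz 6 (by decide)])
  have h0₄ : σ₄.arr 0 = f := (eval_arr _ (by decide) σ₃).trans h0₃
  have h2₄ : σ₄.reg 2 = n := (eval_reg _ (by decide) σ₃).trans h2₃
  have hL₄ : σ₄.reg 0 = L := (eval_reg _ (by decide) σ₃).trans hL₃
  have h4₄ : σ₄.reg 4 = 0 := by
    rw [hσ₄, eval_reg _ (by decide), hσ₃, eval_reg _ (by decide), hσ₂, eval_reg _ (by decide),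
      hσ₁, eval_reg _ (by decide), hrz 4 (by decide)]
  set σ₅ := readRoot.eval σ₄ with hσ₅
  obtain ⟨h3₅, h4₅, h6₅⟩ : σ₅.reg 3 = n + 1 + n * n + n + r ∧ σ₅.reg 4 = r ∧
      σ₅.arr 6 = Function.update (σ₄.arr 6) r 0 := eval_readRoot hf h0₄ hL₄ h2₄ h3₄ h4₄
  have h0₅ : σ₅.arr 0 = f := (eval_arr _ (by decide) σ₄).trans h0₄
  have hL₅ : σ₅.reg 0 = L := (eval_reg _ (by decide) σ₄).trans hL₄
  have h5₅ : σ₅.reg 5 = 0 := by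
    rw [hσ₅, eval_reg _ (by decide), hσ₄, eval_reg _ (by decide), hσ₃, eval_reg _ (by decide),
      hσ₂, eval_reg _ (by decide), hσ₁, eval_reg _ (by decide), hrz 5 (by decide)]
  set σ₆ := readThreshold.eval σ₅ with hσ₆
  have e : readInput.eval σ₀ = σ₆ := rfl
  have harr₆ : ∀ a, a ≠ 6 → σ₆.arr a = σ₃.arr a := fun a ha =>
    (eval_arr _ (by simp [readThreshold, keepsArr]) σ₅).trans
      ((eval_arr _ (by simp [readRoot, keepsArr, ha.symm]) σ₄).trans
        (eval_arr _ (by simp [terminalTable, keepsArr, ha.symm]) σ₃))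
  have hzero : ∀ a, a = 7 ∨ a = 9 → ∀ i, σ₆.arr a i = 0 := by
    intro a ha i
    have h5 : arcTable.keepsArr a = true := by rcases ha with rfl | rfl <;> decide
    rw [harr₆ a (by omega), hσ₃, eval_arr _ h5, harr₂ a (by omega), hz a (by omega)]
  rw [e]
  refine ⟨(eval_reg _ (by decide) σ₅).trans hL₅, (eval_reg _ (by decide) σ₅).trans h4₅,
    eval_readThreshold hf h0₅ hL₅ h3₅ h5₅, ?_, fun v => ?_, hzero 7 (by simp), hzero 9 (by simp)⟩
  · refine ⟨?_, ?_, ?_, ?_, ?_⟩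
    · rw [harr₆ 2 (by decide)]; exact hfill.tail
    · rw [harr₆ 3 (by decide)]; exact hfill.head
    · rw [harr₆ 4 (by decide)]; exact hfill.rev
    · rw [harr₆ 5 (by decide)]; exact hfill.cap
    · rw [harr₆ 5 (by decide)]; exact hfill.support
  · rw [hσ₆, eval_arr _ (by decide), h6₅, Function.update_apply, h6₄]
    by_cases hv : v = r <;> simp [hv]

end RAM

/-! ## The decision problem in polynomial time -/

namespace RAM

open Code

theorem Layout.pos_lt_length {f : ℕ → ℕ} {L n r ℓ : ℕ} (hf : Layout f L n r ℓ) {u v : ℕ}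
    (hu : u < n) (hv : v < n) : pos n u v < L := by
  have := pos_lt hu hv
  have := hf.length
  omega

/-- The network that the memory holds after reading the input. -/
def InputRead.net {f : ℕ → ℕ} {L n r ℓ : ℕ} {σ : Store} (h : InputRead f L n r ℓ σ)
    (hf : Layout f L n r ℓ) : Net where
  L := L
  n := n
  r := r
  U := σ.arr 2
  W := σ.arr 3
  R := σ.arr 4
  good := fun p => ∃ u < n, ∃ v < n, p = pos n u v
  r_lt := hf.r_lt
  n_le := by have := hf.length; omega
  good_lt := by
    rintro _ ⟨u, hu, v, hv, rfl⟩
    exact hf.pos_lt_length hu hv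
  good_ne := by
    rintro _ ⟨u, hu, v, hv, rfl⟩
    unfold pos
    omega
  U_lt := by
    rintro _ ⟨u, hu, v, hv, rfl⟩
    rwa [h.filled.tail u hu v hv trivial]
  W_lt := by
    rintro _ ⟨u, hu, v, hv, rfl⟩
    rwa [h.filled.head u hu v hv trivial]
  good_R := by
    rintro _ ⟨u, hu, v, hv, rfl⟩
    rw [h.filled.rev u hu v hv trivial]
    exact ⟨v, hv, u, hu, rfl⟩
  U_R := by
    rintro _ ⟨u, hu, v, hv, rfl⟩
    rw [h.filled.rev u hu v hv trivial, h.filled.tail v hv u hu trivial,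
      h.filled.head u hu v hv trivial]
  W_R := by
    rintro _ ⟨u, hu, v, hv, rfl⟩
    rw [h.filled.rev u hu v hv trivial, h.filled.head v hv u hu trivial,
      h.filled.tail u hu v hv trivial]

/-- `X` is the side of the root, so arcs leaving `X` are arcs entering its complement. Positions of
the word outside the matrix have capacity `0` and do not contribute. -/
theorem InputRead.cut_eq {f : ℕ → ℕ} {L n r ℓ : ℕ} {σ : Store} (h : InputRead f L n r ℓ σ)
    (hf : Layout f L n r ℓ) (D : Digraph (Fin n))
    (hD : ∀ u v : Fin n, D.Adj u v → f (pos n u v) = 1)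
    (hD' : ∀ u v : Fin n, ¬ D.Adj u v → f (pos n u v) = 0) (X : Finset ℕ) :
    (h.net hf).cut (σ.arr 5) X =
      (DiTree.cutArcs D (Finset.univ.filter fun v : Fin n => (v : ℕ) ∉ X)).ncard := by
  classical
  have hcap : ∀ u v : Fin n, σ.arr 5 (pos n u v) = if D.Adj u v then 1 else 0 := by
    intro u v
    rw [h.filled.cap u u.2 v v.2 trivial]
    split_ifs with hA
    · exact hD u v hA
    · exact hD' u v hA
  rw [Set.ncard_eq_toFinset_card', Finset.card_eq_sum_ones]
  symm
  unfold Net.cut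
  refine Finset.sum_of_injOn (fun a : Fin n × Fin n => pos n a.1 a.2) ?_ ?_ ?_ ?_
  · rintro ⟨u, v⟩ - ⟨u', v'⟩ - he
    obtain ⟨h1, h2⟩ := pos_inj v.2 v'.2 he
    exact Prod.ext (Fin.ext h1) (Fin.ext h2)
  · rintro ⟨u, v⟩ -
    exact Finset.mem_coe.2 (Finset.mem_range.2 (hf.pos_lt_length u.2 v.2))
  · intro p _ hp
    by_contra hne
    split_ifs at hne with hX
    · obtain ⟨u, hu, v, hv, rfl⟩ := h.filled.support p hne
      refine hp ⟨(⟨u, hu⟩, ⟨v, hv⟩), ?_, rfl⟩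
      have h2 : (h.net hf).U (pos n u v) = u := h.filled.tail u hu v hv trivial
      have h3 : (h.net hf).W (pos n u v) = v := h.filled.head u hu v hv trivial
      rw [h2, h3] at hX
      have h4 := hcap ⟨u, hu⟩ ⟨v, hv⟩
      have hA : D.Adj ⟨u, hu⟩ ⟨v, hv⟩ := by
        by_contra hA
        rw [if_neg hA] at h4
        exact hne h4
      rw [Finset.mem_coe, Set.mem_toFinset]
      exact ⟨hA, by simpa using hX.1, by simpa using hX.2⟩
    · exact hne rfl
  · rintro ⟨u, v⟩ ha
    rw [Set.mem_toFinset] at ha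
    obtain ⟨h1, h2, h3⟩ := ha
    have h4 : (h.net hf).U (pos n u v) = u := h.filled.tail u u.2 v v.2 trivial
    have h5 : (h.net hf).W (pos n u v) = v := h.filled.head u u.2 v v.2 trivial
    simp only [Finset.mem_filter, Finset.mem_univ, true_and, not_not] at h1 h2 h3
    rw [h4, h5, if_pos ⟨h2, h3⟩, hcap, if_pos h1]

end RAM

/-! ### The bits of the encoding and correctness of the decision procedure -/

namespace DiTree

open RAM

theorem getD_append_add {α : Type*} (l l' : List α) (i : ℕ) (d : α) :
    (l ++ l').getD (l.length + i) d = l'.getD i d := by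
  rw [List.getD_append_right _ _ _ _ (Nat.le_add_right _ _), Nat.add_sub_cancel_left]

/-- Row-by-row storage: with blocks of equal length `n`, entry `j` of block `i` sits at `i * n + j`.
-/
theorem getD_flatMap {α β : Type*} {g : α → List β} {n : ℕ} (hg : ∀ a, (g a).length = n)
    (l : List α) (d : β) {i j : ℕ} (hi : i < l.length) (hj : j < n) :
    (l.flatMap g).getD (i * n + j) d = (g l[i]).getD j d := by
  induction l generalizing i with
  | nil => simp at hi
  | cons a l ih =>
    rw [List.flatMap_cons]
    cases i with
    | zero => rw [Nat.zero_mul, Nat.zero_add, List.getD_append _ _ _ _ (by rwa [hg])]; rfl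
    | succ i =>
      have e : (i + 1) * n + j = (g a).length + (i * n + j) := by rw [hg]; ring
      rw [e, getD_append_add]
      exact ih (by simpa using hi)

open Classical in
/-- The bits of the adjacency matrix. -/
noncomputable def Input.matrixBits (I : Input) : List Bool :=
  (List.finRange I.n).flatMap fun u => (List.finRange I.n).map fun v => decide (I.D.Adj u v)

open Classical in
/-- The bits of the set of terminals. -/
noncomputable def Input.terminalBits (I : Input) : List Bool :=
  (List.finRange I.n).map fun v => decide (v ∈ I.S)

theorem Input.length_matrixBits (I : Input) : I.matrixBits.length = I.n * I.n := by
  simp [Input.matrixBits, List.length_flatMap]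

theorem Input.length_terminalBits (I : Input) : I.terminalBits.length = I.n := by
  simp [Input.terminalBits]

theorem Input.encode_eq (I : Input) : I.encode = List.replicate I.n true ++ ([false] ++
    (I.matrixBits ++ (I.terminalBits ++ (List.replicate I.r true ++ ([false] ++ Nat.bits I.ℓ))))) := by
  simp [Input.encode, Input.matrixBits, Input.terminalBits]

theorem Input.getD_encode_of_lt (I : Input) {i : ℕ} (hi : i < I.n) :
    I.encode.getD i false = true := by
  rw [I.encode_eq, List.getD_append _ _ _ _ (by simpa using hi)]
  simp [List.getD_eq_getElem?_getD, hi]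

theorem Input.getD_encode_size (I : Input) (i : ℕ) :
    I.encode.getD (I.n + i) false = ([false] ++ (I.matrixBits ++ (I.terminalBits ++
      (List.replicate I.r true ++ ([false] ++ Nat.bits I.ℓ))))).getD i false := by
  rw [I.encode_eq]
  simpa only [List.length_replicate] using getD_append_add (List.replicate I.n true) _ i false

theorem Input.getD_encode_matrix (I : Input) (i : ℕ) :
    I.encode.getD (I.n + 1 + i) false = (I.matrixBits ++ (I.terminalBits ++
      (List.replicate I.r true ++ ([false] ++ Nat.bits I.ℓ)))).getD i false := by
  rw [add_assoc, I.getD_encode_size]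
  exact getD_append_add [false] _ i false

theorem Input.getD_encode_terminals (I : Input) (i : ℕ) :
    I.encode.getD (I.n + 1 + I.n * I.n + i) false = (I.terminalBits ++
      (List.replicate I.r true ++ ([false] ++ Nat.bits I.ℓ))).getD i false := by
  rw [add_assoc (I.n + 1), I.getD_encode_matrix, ← I.length_matrixBits]
  exact getD_append_add _ _ i false

theorem Input.getD_encode_root (I : Input) (i : ℕ) :
    I.encode.getD (I.n + 1 + I.n * I.n + I.n + i) false =
      (List.replicate I.r true ++ ([false] ++ Nat.bits I.ℓ)).getD i false := by
  rw [add_assoc (I.n + 1 + I.n * I.n), I.getD_encode_terminals]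
  have := getD_append_add I.terminalBits
    (List.replicate (I.r : ℕ) true ++ ([false] ++ Nat.bits I.ℓ)) i false
  rwa [I.length_terminalBits] at this

theorem Input.getD_encode_rootEnd (I : Input) (i : ℕ) :
    I.encode.getD (I.n + 1 + I.n * I.n + I.n + I.r + i) false =
      ([false] ++ Nat.bits I.ℓ).getD i false := by
  rw [add_assoc (I.n + 1 + I.n * I.n + I.n), I.getD_encode_root]
  simpa only [List.length_replicate] using
    getD_append_add (List.replicate (I.r : ℕ) true) _ i false

theorem Input.getD_encode_threshold (I : Input) (i : ℕ) :
    I.encode.getD (I.n + 1 + I.n * I.n + I.n + I.r + 1 + i) false = I.ℓ.testBit i := by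
  rw [add_assoc (I.n + 1 + I.n * I.n + I.n + I.r), I.getD_encode_rootEnd]
  refine (getD_append_add [false] _ i false).trans ?_
  rw [Nat.testBit_eq_inth, List.getI_eq_getElem?_getD, List.getD_eq_getElem?_getD]
  rfl

theorem Input.layout (I : Input) :
    Layout (fun i => (I.encode.getD i false).toNat) I.encode.length I.n I.r I.ℓ where
  r_lt := I.r.2
  size_one := fun i hi => by simp only [I.getD_encode_of_lt hi, Bool.toNat_true]
  size_end := by simpa using congrArg Bool.toNat (I.getD_encode_size 0)
  root_one := fun i hi => by
    simp only [I.getD_encode_root]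
    rw [List.getD_append _ _ _ _ (by simpa using hi)]
    simp [List.getD_eq_getElem?_getD, hi]
  root_end := by simpa using congrArg Bool.toNat (I.getD_encode_rootEnd 0)
  bits := fun i => congrArg Bool.toNat (I.getD_encode_threshold i)
  length := by
    rw [I.encode_eq]
    simp only [List.length_append, List.length_replicate, I.length_matrixBits,
      I.length_terminalBits, List.length_singleton, Nat.size_eq_bits_len]
    ring

open Classical in
theorem Input.getD_encode_adj (I : Input) (u v : Fin I.n) :
    I.encode.getD (pos I.n u v) false = decide (I.D.Adj u v) := by
  have hlt : (u : ℕ) * I.n + v < I.matrixBits.length := by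
    have := pos_lt u.2 v.2
    rw [I.length_matrixBits]
    unfold pos at this
    omega
  rw [pos, add_assoc (I.n + 1), I.getD_encode_matrix, List.getD_append _ _ _ _ hlt,
    Input.matrixBits, getD_flatMap (n := I.n) (by simp) _ _ (by simp) v.2]
  simp [List.getD_eq_getElem?_getD]

open Classical in
theorem Input.getD_encode_mem (I : Input) (v : Fin I.n) :
    I.encode.getD (I.n + 1 + I.n * I.n + v) false = decide (v ∈ I.S) := by
  rw [I.getD_encode_terminals, List.getD_append _ _ _ _ (by simp [I.length_terminalBits])]
  simp [Input.terminalBits, List.getD_eq_getElem?_getD]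

theorem polyTimeDecidable_treeConn :
    PolyTimeDecidable Input.encode (fun I => I.Valid ∧ IsEulerian I.D)
      (fun I => (I.ℓ : ℕ∞) ≤ treeConn I.D I.S I.r) := by
  classical
  -- The answer is moved to register `0` only at the end, outside the codes, because these keep the
  -- input length there as loop bound.
  refine ⟨.seq (Code.seq readInput checkAll).compile (.instr (.copy 0 6)),
    (Code.seq readInput checkAll).time + 1, ?_⟩
  rintro I ⟨⟨-, hr, -⟩, hE⟩
  obtain ⟨t, ht, ht'⟩ := Code.runs_compile (Code.seq readInput checkAll) (by decide) (by decide)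
    (initial I.encode)
  refine ⟨_, t + 1, .seq ht (.instr _ _), ?_, ?_⟩
  · have : (initial I.encode).reg 0 = I.encode.length := rfl
    rw [this] at ht'
    simpa using ht'
  have hf := I.layout
  have hread := eval_readInput hf
  rw [Code.eval_seq]
  generalize readInput.eval (initial I.encode) = σ at hread
  set N := hread.net hf with hN
  have hA1 : ∀ p, σ.arr 5 p ≤ 1 := by
    intro p
    by_cases hp : σ.arr 5 p = 0
    · omega
    · obtain ⟨u, hu, v, hv, rfl⟩ := hread.filled.support p hp
      rw [hread.filled.cap u hu v hv trivial]
      exact Bool.toNat_le _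
  have hT : ∀ v : ℕ, σ.arr 6 v ≠ 0 ↔ ∃ h : v < I.n, (⟨v, h⟩ : Fin I.n) ∈ I.S ∧ v ≠ I.r := by
    intro v
    rw [hread.terminals]
    by_cases hv : v < I.n
    · have := I.getD_encode_mem ⟨v, hv⟩
      by_cases hvr : v = I.r
      · simp [hvr]
      · rw [if_pos ⟨hv, hvr⟩, this]
        simp [hv, hvr]
    · simp [hv]
  have hcheck := Net.eval_checkAll (N := N) (A := σ.arr 5) hread.filled.support hA1
    ⟨hread.reg_L, hread.reg_r, rfl, rfl, rfl⟩ rfl (fun p hp => absurd (hread.arr_seven p) hp)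
    (hread.arr_nine _) (fun v hv => by
      obtain ⟨h1, -, h2⟩ := (hT v).1 hv
      exact ⟨h1, h2⟩)
  have hcut : ∀ X : Finset ℕ, N.cut (σ.arr 5) X =
      (cutArcs I.D (Finset.univ.filter fun v : Fin I.n => (v : ℕ) ∉ X)).ncard :=
    hread.cut_eq hf I.D (fun u v h => by simp only [I.getD_encode_adj, h]; rfl)
      (fun u v h => by simp only [I.getD_encode_adj, h]; rfl)
  have hiff : (∀ v, σ.arr 6 v ≠ 0 → ∀ X : Finset ℕ, N.r ∈ X → v ∉ X →
      σ.reg 5 ≤ N.cut (σ.arr 5) X) ↔ (I.ℓ : ℕ∞) ≤ treeConn I.D I.S I.r := by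
    rw [le_treeConn_iff_cuts hE hr, hread.reg_ℓ]
    constructor
    · rintro H Y hrY ⟨s, hs, hsY⟩
      have hsr : s ≠ I.r := fun e => hrY (e ▸ hsY)
      -- The set handed to the network is the complement of `Y`, the side of the root.
      have := H s ((hT s).2 ⟨s.2, hs, fun e => hsr (Fin.ext e)⟩)
        ((Finset.univ.filter fun v => v ∉ Y).map Fin.valEmbedding)
        (by
          change (I.r : ℕ) ∈ _
          rw [Finset.mem_map]
          exact ⟨I.r, by simpa using hrY, rfl⟩)
        (by
          rw [Finset.mem_map]
          rintro ⟨s', hs', e⟩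
          rw [Fin.valEmbedding.injective e] at hs'
          simp [hsY] at hs')
      rw [hcut] at this
      convert this using 3
      ext v
      simp only [Finset.mem_filter, Finset.mem_univ, true_and, Finset.mem_map, not_exists, not_and]
      exact ⟨fun h x hx e => hx (Fin.valEmbedding.injective e ▸ h),
        fun h => by_contra fun hn => h v hn rfl⟩
    · intro H v hv X hrX hvX
      obtain ⟨hvn, hvS, hvr⟩ := (hT v).1 hv
      rw [hcut]
      refine H _ ?_ ⟨_, hvS, by simpa using hvX⟩
      change (I.r : ℕ) ∈ X at hrX
      simpa using hrX
  simp only [hiff] at hcheck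
  have e : (Instr.exec (.copy 0 6) (checkAll.eval σ)).reg 0 = (checkAll.eval σ).reg 6 := by
    simp [Instr.exec]
  rw [e]
  exact hcheck

end DiTree

theorem theorem1 :
    (∀ {V : Type*} [Finite V] (D : Digraph V) (S : Finset V) (r : V) (ℓ : ℕ),
      DiTree.Loopless D → DiTree.IsEulerian D → r ∈ S → 2 ≤ S.card →
        ((ℓ : ℕ∞) ≤ DiTree.treeConn D S r ↔
          ∀ s ∈ S, s ≠ r → (ℓ : ℕ∞) ≤ DiTree.arcConn D r s)) ∧
    RAM.PolyTimeDecidable DiTree.Input.encode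
      (fun I => I.Valid ∧ DiTree.IsEulerian I.D)
      (fun I => (I.ℓ : ℕ∞) ≤ DiTree.treeConn I.D I.S I.r) ∧
    RAM.PolyTimeDecidable DiTree.Input.encode
      (fun I => I.Valid ∧ DiTree.IsSymmetric I.D)
      (fun I => (I.ℓ : ℕ∞) ≤ DiTree.treeConn I.D I.S I.r) := by
  refine ⟨fun D S r ℓ _ hD hr _ => DiTree.le_treeConn_iff_arcConn hD hr ℓ,
    DiTree.polyTimeDecidable_treeConn, ?_⟩
  obtain ⟨P, p, h⟩ := DiTree.polyTimeDecidable_treeConn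
  exact ⟨P, p, fun I hI => h I ⟨hI.1, hI.2.isEulerian⟩⟩
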